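/- Let $\mathcal A$ be a (strict) $2$-category and $\mathbf{Cat}$ the $2$-category of small categories. For a $2$-functor $F\colon\mathcal A\to\mathbf{Cat}$, its $2$-category of elements $\int F$ has as objects the pairs $(B,X)$ with $B\in\mathcal A$ and $X\in F(B)$; as $1$-cells $(B,X)\to(C,X')$ the pairs $(f,\alpha)$ with $f\colon B\to C$ in $\mathcal A$ and $\alpha\colon F(f)(X)\to X'$ in $F(C)$; as $2$-cells $(f,\alpha)\Rightarrow(g,\beta)$ the $2$-cells $\delta\colon f\Rightarrow g$ in $\mathcal A$ with $\alpha=\beta\circ F(\delta)_X$. Identities are $(\mathrm{id},\mathrm{id})$, and $(g,\beta)\circ(f,\alpha)=(g\circ f,\ \beta\circ F(g)(\alpha))$; $2$-cells compose as in $\mathcal A$. It comes with the projection $2$-functor $\int F\to\mathcal A$. Let $[\mathcal A,\mathbf{Cat}]_{\mathrm{lax}}$ be the $2$-category of $2$-functors $\mathcal A\to\mathbf{Cat}$, lax natural transformations $\varphi$ (components $\varphi_B\colon F(B)\to G(B)$ and structure $2$-cells $\varphi_f\colon G(f)\circ\varphi_B\Rightarrow\varphi_C\circ F(f)$ for $f\colon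 B\to C$) and modifications. Let $[\mathcal A,\mathbf{Cat}]_{\mathrm{ps}}$ and $[\mathcal A,\mathbf{Cat}]$ be its locally full sub-$2$-categories on all objects whose $1$-cells are those $\varphi$ with all $\varphi_f$ invertible (pseudonatural transformations), respectively with all $\varphi_f$ identities ($2$-natural transformations). A split discrete $2$-opfibration over $\mathcal A$ is a $2$-functor $P\colon\mathcal E\to\mathcal A$ whose underlying functor is a split Grothendieck opfibration (with a chosen splitting, i.e. a cleavage of chosen opcartesian lifts that is closed under identities and composition), and such that every functor $\mathcal E(X,Y)\to\mathcal A(P X,P Y)$ is a discrete fibration. It has small fibres if for every $B\in\mathcal A$ the fibre category over $B$ is (isomorphic to) a small category. The slice $2\text{-}\mathbf{Cat}/\mathcal A$ has as objects the $2$-functors to $\mathcal A$, as $1$-cells the $2$-functors commuting strictly with the projections to $\mathcal A$, and as $2$-cells the $2$-natural transformations whose whiskering with the projection is an identity. Let $\mathrm{Fib}(\mathcal A)$ be its full sub-$2$-category on the split discrete $2$-opfibrations with small fibres. Let $\mathrm{Fib}'(\mathcal A)$ and $\mathrm{Fib}''(\mathcal A)$ be the locally full sub-$2$-categories of $\mathrm{Fib}(\mathcal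 A)$ on all objects whose $1$-cells are those with underlying functor cartesian (preserving opcartesian morphisms), respectively cleavage preserving (sending chosen lifts to chosen lifts). A $2$-functor is called a $2$-equivalence if it is an isomorphism of categories on each hom-category and every object of the target is isomorphic to the image of some object. **Theorem.** The assignment sending $F$ to the projection $\int F\to\mathcal A$ (with splitting given by the $1$-cells $(f,\mathrm{id})$), a lax natural transformation $\varphi\colon F\to G$ to the $2$-functor $$(B,X)\mapsto(B,\varphi_B(X)),\qquad \big((f,\alpha)\colon(B,X)\to(C,X')\big)\mapsto\big(f,\ \varphi_C(\alpha)\circ(\varphi_f)_X\big),\qquad \delta\mapsto\delta,$$ and a modification $\Theta$ to the $2$-natural transformation with components $(\mathrm{id}_B,\Theta_{B,X})$, is a $2$-equivalence $$\textstyle\int\colon[\mathcal A,\mathbf{Cat}]_{\mathrm{lax}}\ \xrightarrow{\ \sim\ }\ \mathrm{Fib}(\mathcal A).$$ Moreover it restricts to $2$-equivalences $$\textstyle\int\colon[\mathcal A,\mathbf{Cat}]_{\mathrm{ps}}\ \xrightarrow{\ \sim\ }\ \mathrm{Fib}'(\mathcal A)\qquad\text{and}\qquad \int\colon[\mathcal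 A,\mathbf{Cat}]\ \xrightarrow{\ \sim\ }\ \mathrm{Fib}''(\mathcal A).$$ -/

import Mathlib

open CategoryTheory Bicategory
open scoped Lax.LaxTrans Lax.LaxTrans.LaxFunctor

universe w₁ w₂ w₃ v₁ v₂ v₃ u₁ u₂ u₃ w v u t

namespace TwoElements

section TwoFunctors

variable {B : Type u₁} [Bicategory.{w₁, v₁} B] {C : Type u₂} [Bicategory.{w₂, v₂} C]
  {D : Type u₃} [Bicategory.{w₃, v₃} D]

/-- A strict 2-functor is determined by its actions on objects, 1-cells and 2-cells. -/
theorem twoFunctor_ext {F G : StrictPseudofunctor B C}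
    (h : F.toPrelaxFunctor = G.toPrelaxFunctor) : F = G := by
  obtain ⟨⟨⟨pF, idF, compF, _, _, _, _, _⟩, hidF, hidF'⟩, hcF, hcF'⟩ := F
  obtain ⟨⟨⟨pG, idG, compG, _, _, _, _, _⟩, hidG, hidG'⟩, hcG, hcG'⟩ := G
  dsimp at h
  subst h
  obtain rfl : idF = idG := by
    funext X
    exact (hidF' X).trans (hidG' X).symm
  have : @compF = @compG := by
    funext a b c f g
    exact (hcF' f g).trans (hcG' f g).symm
  subst this
  rfl

theorem comp_assoc' {E : Type*} [Bicategory E] (F : StrictPseudofunctor B C)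
    (G : StrictPseudofunctor C D) (H : StrictPseudofunctor D E) :
    (F.comp G).comp H = F.comp (G.comp H) :=
  twoFunctor_ext rfl

theorem id_comp' (F : StrictPseudofunctor B C) :
    (StrictPseudofunctor.id B).comp F = F :=
  twoFunctor_ext rfl

theorem comp_id' (F : StrictPseudofunctor B C) :
    F.comp (StrictPseudofunctor.id C) = F :=
  twoFunctor_ext rfl

/-- A (strict) 2-natural transformation between 2-functors: components are 1-cells, natural
with respect to 1-cells (on the nose) and with respect to 2-cells. -/
structure TwoNatTrans (F G : StrictPseudofunctor B C) where
  app (a : B) : F.obj a ⟶ G.obj a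
  naturality {a b : B} (f : a ⟶ b) : F.map f ≫ app b = app a ≫ G.map f
  naturality₂ {a b : B} {f g : a ⟶ b} (η : f ⟶ g) :
    F.map₂ η ▷ app b ≫ eqToHom (naturality g) = eqToHom (naturality f) ≫ app a ◁ G.map₂ η

namespace TwoNatTrans

@[ext]
theorem ext' {F G : StrictPseudofunctor B C} {θ κ : TwoNatTrans F G}
    (h : ∀ a, θ.app a = κ.app a) : θ = κ := by
  obtain ⟨a, _, _⟩ := θ
  obtain ⟨b, _, _⟩ := κ
  obtain rfl : a = b := funext h
  rfl

variable [Strict C]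

@[simps]
def id (F : StrictPseudofunctor B C) : TwoNatTrans F F where
  app a := 𝟙 (F.obj a)
  naturality f := by rw [Strict.comp_id, Strict.id_comp]
  naturality₂ η := by
    simp [Strict.leftUnitor_eqToIso, Strict.rightUnitor_eqToIso]

@[simps]
def vcomp {F G H : StrictPseudofunctor B C} (θ : TwoNatTrans F G) (κ : TwoNatTrans G H) :
    TwoNatTrans F H where
  app a := θ.app a ≫ κ.app a
  naturality f := by
    rw [← Strict.assoc, θ.naturality, Strict.assoc, κ.naturality, Strict.assoc]
  naturality₂ {a b f g} η := by
    have h1 := θ.naturality₂ η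
    have h2 := κ.naturality₂ η
    have e1 : F.map₂ η ▷ θ.app b =
        eqToHom (θ.naturality f) ≫ θ.app a ◁ G.map₂ η ≫ eqToHom (θ.naturality g).symm := by
      rw [← reassoc_of% h1]; simp
    have e2 : G.map₂ η ▷ κ.app b =
        eqToHom (κ.naturality f) ≫ κ.app a ◁ H.map₂ η ≫ eqToHom (κ.naturality g).symm := by
      rw [← reassoc_of% h2]; simp
    rw [whiskerRight_comp, e1]
    simp only [comp_whiskerRight, whisker_assoc, e2, whiskerLeft_comp, comp_whiskerLeft,
      Strict.associator_eqToIso, eqToIso.hom, eqToIso.inv, whiskerLeft_eqToHom,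
      eqToHom_whiskerRight, Category.assoc, eqToHom_trans, eqToHom_trans_assoc]

@[simps]
def whiskerLeft (F : StrictPseudofunctor B C) {G H : StrictPseudofunctor C D} [Strict D]
    (θ : TwoNatTrans G H) : TwoNatTrans (F.comp G) (F.comp H) where
  app a := θ.app (F.obj a)
  naturality f := θ.naturality (F.map f)
  naturality₂ η := θ.naturality₂ (F.map₂ η)

@[simps]
def whiskerRight {F G : StrictPseudofunctor B C} [Strict D]
    (θ : TwoNatTrans F G) (K : StrictPseudofunctor C D) :
    TwoNatTrans (F.comp K) (G.comp K) where
  app a := K.map (θ.app a)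
  naturality {a b} f := by
    change K.map (F.map f) ≫ K.map (θ.app b) = K.map (θ.app a) ≫ K.map (G.map f)
    rw [← K.map_comp, θ.naturality, K.map_comp]
  naturality₂ {a b f g} η := by
    change K.map₂ (F.map₂ η) ▷ K.map (θ.app b) ≫ eqToHom _ =
      eqToHom _ ≫ K.map (θ.app a) ◁ K.map₂ (G.map₂ η)
    have h := congrArg K.map₂ (θ.naturality₂ η)
    rw [K.map₂_comp, K.map₂_comp, K.map₂_whisker_left, K.map₂_whisker_right,
      K.mapComp_eq_eqToIso, K.mapComp_eq_eqToIso, K.mapComp_eq_eqToIso, K.mapComp_eq_eqToIso,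
      PrelaxFunctor.map₂_eqToHom, PrelaxFunctor.map₂_eqToHom] at h
    simp only [eqToIso.hom, eqToIso.inv, Category.assoc, eqToHom_trans, eqToHom_trans_assoc] at h
    have h' := congrArg (fun t => eqToHom (K.map_comp _ _).symm ≫ t ≫ eqToHom (K.map_comp _ _)) h
    simpa using h'

end TwoNatTrans

end TwoFunctors

set_option linter.checkUnivs false in
/-- A 2-category over `A`: a 2-category `carrier` with a 2-functor `proj` to `A`.
These are the objects of the strict slice `2-Cat / A`. -/
structure TwoCatOver (A : Type u₁) [Bicategory.{w₁, v₁} A] [Strict A] where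
  carrier : Type u₂
  [bicategory : Bicategory.{w₂, v₂} carrier]
  [strict : Strict carrier]
  proj : StrictPseudofunctor carrier A

namespace TwoCatOver

attribute [instance] TwoCatOver.bicategory TwoCatOver.strict

variable {A : Type u₁} [Bicategory.{w₁, v₁} A] [Strict A]

/-- A 1-cell of `2-Cat / A`: a 2-functor commuting with the projections to `A`. -/
structure Hom (X Y : TwoCatOver.{w₁, w₂, v₁, v₂, u₁, u₂} A) where
  functor : StrictPseudofunctor X.carrier Y.carrier
  comm : functor.comp Y.proj = X.proj

instance : CategoryStruct (TwoCatOver.{w₁, w₂, v₁, v₂, u₁, u₂} A) where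
  Hom := Hom
  id X := ⟨StrictPseudofunctor.id X.carrier, id_comp' _⟩
  comp H K := ⟨H.functor.comp K.functor, by rw [comp_assoc', K.comm, H.comm]⟩

variable {X Y Z : TwoCatOver.{w₁, w₂, v₁, v₂, u₁, u₂} A}

@[ext]
theorem hom_ext {H K : X ⟶ Y} (h : H.functor = K.functor) : H = K := by
  obtain ⟨H, _⟩ := H
  obtain ⟨K, _⟩ := K
  dsimp at h
  subst h
  rfl

@[simp] theorem id_functor : Hom.functor (𝟙 X) = StrictPseudofunctor.id X.carrier := rfl
@[simp] theorem comp_functor (H : X ⟶ Y) (K : Y ⟶ Z) :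
    (H ≫ K).functor = H.functor.comp K.functor := rfl

theorem proj_obj (H : X ⟶ Y) (x : X.carrier) :
    Y.proj.obj (H.functor.obj x) = X.proj.obj x :=
  congrArg (fun P : StrictPseudofunctor X.carrier A => P.obj x) H.comm

theorem isHomLift_map (H : X ⟶ Y) {x y : X.carrier} {a b : A} (f : a ⟶ b) (φ : x ⟶ y)
    [h : X.proj.toFunctor.IsHomLift f φ] : Y.proj.toFunctor.IsHomLift f (H.functor.map φ) := by
  have e : ∀ P : StrictPseudofunctor X.carrier A, H.functor.comp Y.proj = P →
      P.toFunctor.IsHomLift f φ → Y.proj.toFunctor.IsHomLift f (H.functor.map φ) := by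
    rintro _ rfl h
    obtain ⟨⟩ := h
    exact Functor.IsHomLift.map (p := Y.proj.toFunctor) (H.functor.map φ)
  exact e _ H.comm h

/-- A 2-cell of `2-Cat / A`: a 2-natural transformation whose whiskering with the projection is
the identity, i.e. all of whose components lie over identities of `A`. -/
structure Hom₂ (H K : X ⟶ Y) where
  trans : TwoNatTrans H.functor K.functor
  vertical (x : X.carrier) : Y.proj.toFunctor.IsHomLift (𝟙 (X.proj.obj x)) (trans.app x)

instance (X Y : TwoCatOver.{w₁, w₂, v₁, v₂, u₁, u₂} A) : Category (X ⟶ Y) where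
  Hom := Hom₂
  id H := ⟨TwoNatTrans.id _, fun x => IsHomLift.id (proj_obj H x)⟩
  comp θ κ := ⟨θ.trans.vcomp κ.trans, fun x => by
    have := θ.vertical x
    have := κ.vertical x
    exact IsHomLift.comp_of_lift_id _ _ _ _⟩
  id_comp θ := by
    obtain ⟨θ, _⟩ := θ
    congr 1
    ext x
    exact Strict.id_comp _
  comp_id θ := by
    obtain ⟨θ, _⟩ := θ
    congr 1
    ext x
    exact Strict.comp_id _
  assoc _ _ _ := by
    congr 1
    ext x
    exact Strict.assoc _ _ _

@[ext]
theorem hom₂_ext {H K : X ⟶ Y} {θ κ : H ⟶ K} (h : ∀ x, θ.trans.app x = κ.trans.app x) :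
    θ = κ := by
  obtain ⟨θ, _⟩ := θ
  obtain ⟨κ, _⟩ := κ
  obtain rfl : θ = κ := TwoNatTrans.ext' h
  rfl

@[simp] theorem id_trans_app (H : X ⟶ Y) (x : X.carrier) :
    (𝟙 H : H ⟶ H).trans.app x = 𝟙 (H.functor.obj x) := rfl
@[simp] theorem comp_trans_app {H K L : X ⟶ Y} (θ : H ⟶ K) (κ : K ⟶ L) (x : X.carrier) :
    (θ ≫ κ).trans.app x = θ.trans.app x ≫ κ.trans.app x := rfl

theorem eqToHom_trans_app {H K : X ⟶ Y} (h : H = K) (x : X.carrier) :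
    (eqToHom h).trans.app x = eqToHom (by rw [h]) := by
  subst h
  rfl

def whiskerLeft (H : X ⟶ Y) {K L : Y ⟶ Z} (θ : K ⟶ L) : H ≫ K ⟶ H ≫ L :=
  Hom₂.mk (TwoNatTrans.whiskerLeft H.functor θ.trans) fun x => by
    have := θ.vertical (H.functor.obj x)
    rwa [proj_obj H x] at this

def whiskerRight {H K : X ⟶ Y} (θ : H ⟶ K) (L : Y ⟶ Z) : H ≫ L ⟶ K ≫ L :=
  Hom₂.mk (TwoNatTrans.whiskerRight θ.trans L.functor) fun x => by
    have := θ.vertical x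
    exact isHomLift_map L _ _

@[simp] theorem whiskerLeft_trans_app (H : X ⟶ Y) {K L : Y ⟶ Z} (θ : K ⟶ L) (x : X.carrier) :
    (whiskerLeft H θ).trans.app x = θ.trans.app (H.functor.obj x) := rfl
@[simp] theorem whiskerRight_trans_app {H K : X ⟶ Y} (θ : H ⟶ K) (L : Y ⟶ Z) (x : X.carrier) :
    (whiskerRight θ L).trans.app x = L.functor.map (θ.trans.app x) := rfl

theorem hom_id_comp (H : X ⟶ Y) : 𝟙 X ≫ H = H := hom_ext (id_comp' _)
theorem hom_comp_id (H : X ⟶ Y) : H ≫ 𝟙 Y = H := hom_ext (comp_id' _)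
theorem hom_assoc {W : TwoCatOver.{w₁, w₂, v₁, v₂, u₁, u₂} A} (H : X ⟶ Y) (K : Y ⟶ Z)
    (L : Z ⟶ W) : (H ≫ K) ≫ L = H ≫ K ≫ L := hom_ext (comp_assoc' _ _ _)

theorem whiskerLeft_eqToHom' (H : X ⟶ Y) {K L : Y ⟶ Z} (h : K = L) :
    whiskerLeft H (eqToHom h) = eqToHom (by rw [h]) := by
  subst h
  rfl

theorem whiskerRight_eqToHom' {H K : X ⟶ Y} (h : H = K) (L : Y ⟶ Z) :
    whiskerRight (eqToHom h) L = eqToHom (by rw [h]) := by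
  subst h
  exact hom₂_ext fun x => L.functor.map_id _

theorem conj_id {a b : X.carrier} (f : a ⟶ b) : f = 𝟙 a ≫ f ≫ 𝟙 b := by simp

theorem conj_eqToHom {H K H' K' : X ⟶ Y} (h : H' = H) (h' : K = K') (θ : H ⟶ K) (κ : H' ⟶ K')
    (w : ∀ x, κ.trans.app x = eqToHom (by rw [h]) ≫ θ.trans.app x ≫ eqToHom (by rw [h'])) :
    κ = eqToHom h ≫ θ ≫ eqToHom h' := by
  ext x
  rw [comp_trans_app, comp_trans_app, eqToHom_trans_app, eqToHom_trans_app, w x]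

/-- The strict slice 2-category `2-Cat / A`. -/
instance : Bicategory (TwoCatOver.{w₁, w₂, v₁, v₂, u₁, u₂} A) where
  whiskerLeft H _ _ θ := whiskerLeft H θ
  whiskerRight θ K := whiskerRight θ K
  associator H K L := eqToIso (hom_assoc H K L)
  leftUnitor H := eqToIso (hom_id_comp H)
  rightUnitor H := eqToIso (hom_comp_id H)
  whiskerLeft_id _ _ := rfl
  whiskerLeft_comp _ _ _ _ _ _ := rfl
  id_whiskerLeft θ := conj_eqToHom (hom_id_comp _) (hom_id_comp _).symm _ _ fun x => conj_id _
  comp_whiskerLeft F G H H' η :=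
    conj_eqToHom (hom_assoc _ _ _) (hom_assoc _ _ _).symm _ _ fun x => conj_id _
  id_whiskerRight H K := hom₂_ext fun x => K.functor.map_id _
  comp_whiskerRight θ κ K := hom₂_ext fun x => K.functor.map_comp _ _
  whiskerRight_id θ := conj_eqToHom (hom_comp_id _) (hom_comp_id _).symm _ _ fun x => conj_id _
  whiskerRight_comp θ κ K :=
    conj_eqToHom (hom_assoc _ _ _).symm (hom_assoc _ _ _) _ _ fun x => conj_id _
  whisker_assoc H _ _ θ K :=
    conj_eqToHom (hom_assoc _ _ _) (hom_assoc _ _ _).symm _ _ fun x => conj_id _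
  whisker_exchange θ κ := hom₂_ext fun x => ((Hom₂.trans κ).naturality _).symm
  pentagon H K L M := by
    simp only [eqToIso.hom, eqToHom_trans, whiskerLeft_eqToHom',
      whiskerRight_eqToHom']
  triangle H K := by
    simp only [eqToIso.hom, eqToHom_trans, whiskerLeft_eqToHom',
      whiskerRight_eqToHom']

instance : Strict (TwoCatOver.{w₁, w₂, v₁, v₂, u₁, u₂} A) where
  id_comp := hom_id_comp
  comp_id := hom_comp_id
  assoc := hom_assoc
  leftUnitor_eqToIso _ := rfl
  rightUnitor_eqToIso _ := rfl
  associator_eqToIso _ _ _ := rfl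

end TwoCatOver

section LaxTransformations

variable {B : Type u₁} [Bicategory.{w₁, v₁} B] {C : Type u₂} [Bicategory.{w₂, v₂} C]

theorem laxTrans_ext {F G : B ⥤ᴸ C} {η θ : F ⟶ G} (h : ∀ a, η.app a = θ.app a)
    (h' : ∀ {a b : B} (f : a ⟶ b), η.naturality f ≫ eqToHom (by rw [h b]) =
      eqToHom (by rw [h a]) ≫ θ.naturality f) : η = θ := by
  obtain ⟨appη, natη, _, _, _⟩ := η
  obtain ⟨appθ, natθ, _, _, _⟩ := θ
  obtain rfl : appη = appθ := funext h
  have : @natη = @natθ := by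
    funext a b f
    simpa using h' f
  subst this
  rfl

theorem laxTrans_eqToHom_app {F G : B ⥤ᴸ C} {η θ : F ⟶ G} (h : η = θ) (a : B) :
    (eqToHom h).as.app a = eqToHom (by rw [h]) := by
  subst h
  rfl

section

variable [Strict C]

theorem id_comp_aux {x y z t : C} {p : x ⟶ y} {q : y ⟶ z} {r : x ⟶ t} {s : t ⟶ z}
    (n : p ≫ q ⟶ r ≫ s) (h : r ≫ 𝟙 t ≫ s = r ≫ s) (h' : (𝟙 x ≫ p) ≫ q = p ≫ q) :
    ((α_ (𝟙 x) p q).hom ≫ 𝟙 x ◁ n ≫ (α_ (𝟙 x) r s).inv ≫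
      ((λ_ r).hom ≫ (ρ_ r).inv) ▷ s ≫ (α_ r (𝟙 t) s).hom) ≫ eqToHom h = eqToHom h' ≫ n := by
  simp [Strict.leftUnitor_eqToIso, Strict.rightUnitor_eqToIso, Strict.associator_eqToIso]

theorem comp_id_aux {x y z t : C} {p : x ⟶ y} {q : y ⟶ z} {r : x ⟶ t} {s : t ⟶ z}
    (n : p ≫ q ⟶ r ≫ s) (h : r ≫ s ≫ 𝟙 z = r ≫ s) (h' : (p ≫ 𝟙 y) ≫ q = p ≫ q) :
    ((α_ p (𝟙 y) q).hom ≫ p ◁ ((λ_ q).hom ≫ (ρ_ q).inv) ≫ (α_ p q (𝟙 z)).inv ≫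
      n ▷ 𝟙 z ≫ (α_ r s (𝟙 z)).hom) ≫ eqToHom h = eqToHom h' ≫ n := by
  simp [Strict.leftUnitor_eqToIso, Strict.rightUnitor_eqToIso, Strict.associator_eqToIso]

theorem assoc_aux {x y z t x' y' z' t' : C} {f : x ⟶ x'} {g : y ⟶ y'} {h : z ⟶ z'}
    {k : t ⟶ t'} {p : x ⟶ y} {q : y ⟶ z} {r : z ⟶ t} {p' : x' ⟶ y'} {q' : y' ⟶ z'} {r' : z' ⟶ t'}
    (n₁ : p ≫ g ⟶ f ≫ p') (n₂ : q ≫ h ⟶ g ≫ q') (n₃ : r ≫ k ⟶ h ≫ r')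
    (e : f ≫ (p' ≫ q') ≫ r' = f ≫ p' ≫ q' ≫ r')
    (e' : ((p ≫ q) ≫ r) ≫ k = (p ≫ q ≫ r) ≫ k) :
    ((α_ (p ≫ q) r k).hom ≫ (p ≫ q) ◁ n₃ ≫ (α_ (p ≫ q) h r').inv ≫
        ((α_ p q h).hom ≫ p ◁ n₂ ≫ (α_ p g q').inv ≫ n₁ ▷ q' ≫ (α_ f p' q').hom) ▷ r' ≫
              (α_ f (p' ≫ q') r').hom) ≫ eqToHom e =
      eqToHom e' ≫ (α_ p (q ≫ r) k).hom ≫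
      p ◁ ((α_ q r k).hom ≫ q ◁ n₃ ≫ (α_ q h r').inv ≫ n₂ ▷ r' ≫ (α_ g q' r').hom) ≫
        (α_ p g (q' ≫ r')).inv ≫ n₁ ▷ (q' ≫ r') ≫ (α_ f p' (q' ≫ r')).hom := by
  simp [Strict.associator_eqToIso]

end

/-- Lax functors, lax transformations and modifications form a strict 2-category as soon as
the target is strict. -/
instance laxFunctor_strict [Strict C] : Strict (B ⥤ᴸ C) where
  id_comp η := laxTrans_ext (fun a => Strict.id_comp _) fun f => id_comp_aux _ _ _
  comp_id η := laxTrans_ext (fun a => Strict.comp_id _) fun f => comp_id_aux _ _ _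
  assoc η θ κ := laxTrans_ext (fun a => Strict.assoc _ _ _) fun f => assoc_aux _ _ _ _ _
  leftUnitor_eqToIso η := by
    ext a
    rw [eqToIso.hom, laxTrans_eqToHom_app]
    exact congrArg Iso.hom (Strict.leftUnitor_eqToIso (η.app a))
  rightUnitor_eqToIso η := by
    ext a
    rw [eqToIso.hom, laxTrans_eqToHom_app]
    exact congrArg Iso.hom (Strict.rightUnitor_eqToIso (η.app a))
  associator_eqToIso η θ κ := by
    ext a
    rw [eqToIso.hom, laxTrans_eqToHom_app]
    exact congrArg Iso.hom (Strict.associator_eqToIso (η.app a) (θ.app a) (κ.app a))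

end LaxTransformations

section Elements

variable {A : Type u} [Bicategory.{w, v} A]

/-- An object of the 2-category of elements of `F : A → Cat`: a pair `(B, X)` with `X ∈ F B`. -/
structure Elements (F : StrictPseudofunctor A Cat.{t, t}) : Type (max u t) where
  base : A
  fiber : F.obj base

namespace Elements

variable {F : StrictPseudofunctor A Cat.{t, t}}

/-- A 1-cell `(B, X) ⟶ (C, X')`: a pair of `f : B ⟶ C` and `α : F f X ⟶ X'`. -/
@[ext]
structure Hom (X Y : Elements F) : Type (max v t) where
  base : X.base ⟶ Y.base
  fiber : (F.map base).toFunctor.obj X.fiber ⟶ Y.fiber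

/- As `F` is a strict 2-functor, `F.mapId` and `F.mapComp` are identities. -/
instance : CategoryStruct (Elements F) where
  Hom X Y := Hom X Y
  id X := ⟨𝟙 X.base, (F.mapId X.base).hom.toNatTrans.app X.fiber⟩
  comp {X _ _} f g := ⟨f.base ≫ g.base,
    (F.mapComp f.base g.base).hom.toNatTrans.app X.fiber ≫
      (F.map g.base).toFunctor.map f.fiber ≫ g.fiber⟩

variable {X Y Z : Elements F}

@[simp] theorem id_base : Hom.base (𝟙 X) = 𝟙 X.base := rfl
@[simp] theorem id_fiber : Hom.fiber (𝟙 X) = (F.mapId X.base).hom.toNatTrans.app X.fiber := rfl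
@[simp] theorem comp_base (f : X ⟶ Y) (g : Y ⟶ Z) : (f ≫ g).base = f.base ≫ g.base := rfl
@[simp] theorem comp_fiber (f : X ⟶ Y) (g : Y ⟶ Z) : (f ≫ g).fiber =
    (F.mapComp f.base g.base).hom.toNatTrans.app X.fiber ≫
      (F.map g.base).toFunctor.map f.fiber ≫ g.fiber := rfl

/-- A 2-cell `(f, α) ⟶ (g, β)`: a 2-cell `δ : f ⟶ g` of `A` with `α = β ∘ (F δ)_X`. -/
@[ext]
structure Hom₂ (f g : X ⟶ Y) : Type w where
  base : f.base ⟶ g.base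
  comm : f.fiber = (F.map₂ base).toNatTrans.app X.fiber ≫ g.fiber

instance (X Y : Elements F) : Category (X ⟶ Y) where
  Hom f g := Hom₂ f g
  id f := ⟨𝟙 f.base, by simp⟩
  comp δ κ := ⟨δ.base ≫ κ.base, by rw [δ.comm, κ.comm]; simp⟩
  id_comp _ := Hom₂.ext (Category.id_comp _)
  comp_id _ := Hom₂.ext (Category.comp_id _)
  assoc _ _ _ := Hom₂.ext (Category.assoc _ _ _)

@[ext]
theorem hom₂_ext {f g : X ⟶ Y} {δ κ : f ⟶ g} (h : δ.base = κ.base) : δ = κ := Hom₂.ext h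

@[simp] theorem id_base₂ (f : X ⟶ Y) : (𝟙 f : f ⟶ f).base = 𝟙 f.base := rfl
@[simp] theorem comp_base₂ {f g h : X ⟶ Y} (δ : f ⟶ g) (κ : g ⟶ h) :
    (δ ≫ κ).base = δ.base ≫ κ.base := rfl

@[simps]
def isoMk {f g : X ⟶ Y} (e : f.base ≅ g.base)
    (h : f.fiber = (F.map₂ e.hom).toNatTrans.app X.fiber ≫ g.fiber) : f ≅ g where
  hom := Hom₂.mk e.hom h
  inv := Hom₂.mk e.inv (by
    have := congrArg (fun α => α.toNatTrans.app X.fiber) (F.map₂_inv_hom e)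
    dsimp at this
    rw [h, reassoc_of% this])
  hom_inv_id := hom₂_ext e.hom_inv_id
  inv_hom_id := hom₂_ext e.inv_hom_id

def whiskerLeft (f : X ⟶ Y) {g h : Y ⟶ Z} (δ : g ⟶ h) : f ≫ g ⟶ f ≫ h :=
  Hom₂.mk (f.base ◁ δ.base) (by
    rw [comp_fiber, comp_fiber, δ.comm, F.map₂_whisker_left]
    simp)

def whiskerRight {f g : X ⟶ Y} (δ : f ⟶ g) (h : Y ⟶ Z) : f ≫ h ⟶ g ≫ h :=
  Hom₂.mk (δ.base ▷ h.base) (by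
    rw [comp_fiber, comp_fiber, δ.comm, F.map₂_whisker_right]
    simp)

def associator {W : Elements F} (f : X ⟶ Y) (g : Y ⟶ Z) (h : Z ⟶ W) :
    (f ≫ g) ≫ h ≅ f ≫ g ≫ h :=
  isoMk (α_ f.base g.base h.base) (by
    rw [F.map₂_associator]
    simp)

def leftUnitor (f : X ⟶ Y) : 𝟙 X ≫ f ≅ f :=
  isoMk (λ_ f.base) (by
    rw [F.map₂_left_unitor]
    simp)

def rightUnitor (f : X ⟶ Y) : f ≫ 𝟙 Y ≅ f :=
  isoMk (ρ_ f.base) (by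
    rw [F.map₂_right_unitor]
    simp)

/-- The 2-category of elements of `F`; all compositions are inherited from `A`. -/
instance : Bicategory (Elements F) where
  whiskerLeft f _ _ δ := whiskerLeft f δ
  whiskerRight δ h := whiskerRight δ h
  associator := associator
  leftUnitor := leftUnitor
  rightUnitor := rightUnitor
  whiskerLeft_id _ _ := hom₂_ext (Bicategory.whiskerLeft_id _ _)
  whiskerLeft_comp _ _ _ _ _ _ := hom₂_ext (Bicategory.whiskerLeft_comp _ _ _)
  id_whiskerLeft _ := hom₂_ext (Bicategory.id_whiskerLeft _)
  comp_whiskerLeft _ _ _ _ _ := hom₂_ext (Bicategory.comp_whiskerLeft _ _ _)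
  id_whiskerRight _ _ := hom₂_ext (Bicategory.id_whiskerRight _ _)
  comp_whiskerRight _ _ _ := hom₂_ext (Bicategory.comp_whiskerRight _ _ _)
  whiskerRight_id _ := hom₂_ext (Bicategory.whiskerRight_id _)
  whiskerRight_comp _ _ _ := hom₂_ext (Bicategory.whiskerRight_comp _ _ _)
  whisker_assoc _ _ _ _ _ := hom₂_ext (Bicategory.whisker_assoc _ _ _)
  whisker_exchange _ _ := hom₂_ext (Bicategory.whisker_exchange _ _)
  pentagon _ _ _ _ := hom₂_ext (Bicategory.pentagon _ _ _ _)
  triangle _ _ := hom₂_ext (Bicategory.triangle _ _)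

theorem eqToHom_base {f g : X ⟶ Y} (h : f = g) :
    (eqToHom h).base = eqToHom (by rw [h]) := by
  subst h
  rfl

theorem eq_of_hom₂ {f g : X ⟶ Y} (δ : f ⟶ g) (h : f.base = g.base)
    (hδ : δ.base = eqToHom h) : f = g := by
  have hc := δ.comm
  rw [hδ] at hc
  obtain ⟨fb, ff⟩ := f
  obtain ⟨gb, gf⟩ := g
  dsimp at h
  subst h
  obtain rfl : ff = gf := by simpa using hc
  rfl

theorem mapId_app (B : A) (x : F.obj B) : (F.mapId B).hom.toNatTrans.app x =
    eqToHom (by rw [F.map_id]) := by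
  rw [F.mapId_eq_eqToIso]
  exact Cat.eqToHom_app _ _ (F.map_id B) _

theorem mapComp_app {B C D : A} (f : B ⟶ C) (g : C ⟶ D) (x : F.obj B) :
    (F.mapComp f g).hom.toNatTrans.app x = eqToHom (by rw [F.map_comp]) := by
  rw [F.mapComp_eq_eqToIso]
  exact Cat.eqToHom_app _ _ (F.map_comp f g) _

section Map

variable {G H : StrictPseudofunctor A Cat.{t, t}}

/-- The component functor `φ_B : F B ⥤ G B` of a lax transformation. -/
def laxApp (φ : Lax.LaxTrans F.toLax G.toLax) (B : A) : F.obj B ⥤ G.obj B :=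
  (φ.app B).toFunctor

/-- The component at `X` of the structure 2-cell of a lax transformation at `f`,
`(φ_f)_X : G f (φ_B X) ⟶ φ_C (F f X)`. -/
def laxStr (φ : Lax.LaxTrans F.toLax G.toLax) {B C : A} (f : B ⟶ C) (X : F.obj B) :
    (G.map f).toFunctor.obj ((laxApp φ B).obj X) ⟶
      (laxApp φ C).obj ((F.map f).toFunctor.obj X) :=
  (φ.naturality f).toNatTrans.app X

variable (φ : Lax.LaxTrans F.toLax G.toLax)

theorem laxStr_naturality {B C : A} (f : B ⟶ C) {X X' : F.obj B} (α : X ⟶ X') :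
    (G.map f).toFunctor.map ((laxApp φ B).map α) ≫ laxStr φ f X' =
      laxStr φ f X ≫ (laxApp φ C).map ((F.map f).toFunctor.map α) :=
  (φ.naturality f).toNatTrans.naturality α

theorem laxStr_map₂ {B C : A} {f g : B ⟶ C} (δ : f ⟶ g) (X : F.obj B) :
    laxStr φ f X ≫ (laxApp φ C).map ((F.map₂ δ).toNatTrans.app X) =
      (G.map₂ δ).toNatTrans.app ((laxApp φ B).obj X) ≫ laxStr φ g X :=
  congrArg (fun α => α.toNatTrans.app X) (φ.naturality_naturality δ)

theorem laxStr_id (B : A) (X : F.obj B) :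
    laxStr φ (𝟙 B) X ≫ (laxApp φ B).map ((F.mapId B).hom.toNatTrans.app X) =
      (G.mapId B).hom.toNatTrans.app ((laxApp φ B).obj X) := by
  have h : (G.mapId B).inv.toNatTrans.app ((laxApp φ B).obj X) ≫ laxStr φ (𝟙 B) X =
      (𝟙 _ ≫ 𝟙 _ ≫ (laxApp φ B).map ((F.mapId B).inv.toNatTrans.app X)) :=
    congrArg (fun α => α.toNatTrans.app X) (φ.naturality_id B)
  have h₁ := congrArg (fun t => (G.mapId B).hom.toNatTrans.app ((laxApp φ B).obj X) ≫ t ≫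
    (laxApp φ B).map ((F.mapId B).hom.toNatTrans.app X)) h
  have h₂ : (laxApp φ B).map ((F.mapId B).inv.toNatTrans.app X) ≫
      (laxApp φ B).map ((F.mapId B).hom.toNatTrans.app X) = 𝟙 _ := by
    rw [← Functor.map_comp]
    simp
  simpa [h₂] using h₁

theorem laxStr_comp {B C D : A} (f : B ⟶ C) (g : C ⟶ D) (X : F.obj B) :
    laxStr φ (f ≫ g) X ≫ (laxApp φ D).map ((F.mapComp f g).hom.toNatTrans.app X) =
      (G.mapComp f g).hom.toNatTrans.app ((laxApp φ B).obj X) ≫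
        (G.map g).toFunctor.map (laxStr φ f X) ≫ laxStr φ g ((F.map f).toFunctor.obj X) := by
  have h : (G.mapComp f g).inv.toNatTrans.app ((laxApp φ B).obj X) ≫ laxStr φ (f ≫ g) X =
      (𝟙 _ ≫ (G.map g).toFunctor.map (laxStr φ f X) ≫ 𝟙 _ ≫
        laxStr φ g ((F.map f).toFunctor.obj X) ≫ 𝟙 _ ≫
          (laxApp φ D).map ((F.mapComp f g).inv.toNatTrans.app X)) :=
    congrArg (fun α => α.toNatTrans.app X) (φ.naturality_comp f g)
  have h₁ := congrArg (fun t => (G.mapComp f g).hom.toNatTrans.app ((laxApp φ B).obj X) ≫ t ≫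
    (laxApp φ D).map ((F.mapComp f g).hom.toNatTrans.app X)) h
  have h₂ : (laxApp φ D).map ((F.mapComp f g).inv.toNatTrans.app X) ≫
      (laxApp φ D).map ((F.mapComp f g).hom.toNatTrans.app X) = 𝟙 _ := by
    rw [← Functor.map_comp]
    simp
  simpa [h₂] using h₁

theorem mapHom₂_comm {X Y : Elements F} {f g : X ⟶ Y} (δ : f ⟶ g) :
    laxStr φ f.base X.fiber ≫ (laxApp φ Y.base).map f.fiber =
      (G.map₂ δ.base).toNatTrans.app ((laxApp φ X.base).obj X.fiber) ≫
        laxStr φ g.base X.fiber ≫ (laxApp φ Y.base).map g.fiber := by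
  rw [δ.comm, Functor.map_comp, ← Category.assoc, laxStr_map₂, Category.assoc]

theorem mapHom_comp_fiber {X Y Z : Elements F} (f : X ⟶ Y) (g : Y ⟶ Z) :
    laxStr φ (f.base ≫ g.base) X.fiber ≫ (laxApp φ Z.base).map (f ≫ g).fiber =
      (G.mapComp f.base g.base).hom.toNatTrans.app ((laxApp φ X.base).obj X.fiber) ≫
        (G.map g.base).toFunctor.map
          (laxStr φ f.base X.fiber ≫ (laxApp φ Y.base).map f.fiber) ≫
            laxStr φ g.base Y.fiber ≫ (laxApp φ Z.base).map g.fiber := by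
  rw [comp_fiber, Functor.map_comp, Functor.map_comp, Functor.map_comp, ← Category.assoc,
    laxStr_comp]
  simp only [Category.assoc]
  rw [reassoc_of% laxStr_naturality φ g.base f.fiber]

def mapObj (X : Elements F) : Elements G := ⟨X.base, (laxApp φ X.base).obj X.fiber⟩

def mapHom {X Y : Elements F} (f : X ⟶ Y) : mapObj φ X ⟶ mapObj φ Y :=
  Hom.mk f.base (laxStr φ f.base X.fiber ≫ (laxApp φ Y.base).map f.fiber)

def mapHom₂ {X Y : Elements F} {f g : X ⟶ Y} (δ : f ⟶ g) : mapHom φ f ⟶ mapHom φ g :=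
  Hom₂.mk δ.base (mapHom₂_comm φ δ)

theorem mapHom_id (X : Elements F) : mapHom φ (𝟙 X) = 𝟙 (mapObj φ X) :=
  Hom.ext rfl (heq_of_eq (laxStr_id φ X.base X.fiber))

theorem mapHom_comp {X Y Z : Elements F} (f : X ⟶ Y) (g : Y ⟶ Z) :
    mapHom φ (f ≫ g) = mapHom φ f ≫ mapHom φ g :=
  Hom.ext rfl (heq_of_eq (mapHom_comp_fiber φ f g))

/-- The component at `X` of `Θ_B` for a modification `Θ`. -/
def modApp {φ ψ : F.toLax ⟶ G.toLax} (Θ : φ ⟶ ψ) (B : A) (X : F.obj B) :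
    (laxApp φ B).obj X ⟶ (laxApp ψ B).obj X :=
  (Θ.as.app B).toNatTrans.app X

theorem modApp_naturality {φ ψ : F.toLax ⟶ G.toLax} (Θ : φ ⟶ ψ) (B : A) {X X' : F.obj B}
    (α : X ⟶ X') :
    (laxApp φ B).map α ≫ modApp Θ B X' = modApp Θ B X ≫ (laxApp ψ B).map α :=
  (Θ.as.app B).toNatTrans.naturality α

theorem modApp_laxStr {φ ψ : F.toLax ⟶ G.toLax} (Θ : φ ⟶ ψ) {B C : A} (f : B ⟶ C)
    (X : F.obj B) :
    (G.map f).toFunctor.map (modApp Θ B X) ≫ laxStr ψ f X =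
      laxStr φ f X ≫ modApp Θ C ((F.map f).toFunctor.obj X) :=
  congrArg (fun α => α.toNatTrans.app X) (Θ.as.naturality f)

end Map

variable [Strict A]

instance : Strict (Elements F) where
  id_comp f := eq_of_hom₂ (λ_ f).hom (Strict.id_comp _)
    (congrArg Iso.hom (Strict.leftUnitor_eqToIso f.base))
  comp_id f := eq_of_hom₂ (ρ_ f).hom (Strict.comp_id _)
    (congrArg Iso.hom (Strict.rightUnitor_eqToIso f.base))
  assoc f g h := eq_of_hom₂ (α_ f g h).hom (Strict.assoc _ _ _)
    (congrArg Iso.hom (Strict.associator_eqToIso f.base g.base h.base))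
  leftUnitor_eqToIso f := by
    ext
    rw [eqToIso.hom, eqToHom_base]
    exact congrArg Iso.hom (Strict.leftUnitor_eqToIso f.base)
  rightUnitor_eqToIso f := by
    ext
    rw [eqToIso.hom, eqToHom_base]
    exact congrArg Iso.hom (Strict.rightUnitor_eqToIso f.base)
  associator_eqToIso f g h := by
    ext
    rw [eqToIso.hom, eqToHom_base]
    exact congrArg Iso.hom (Strict.associator_eqToIso f.base g.base h.base)

variable (F) in
/-- The projection of the 2-category of elements. -/
def proj : StrictPseudofunctor (Elements F) A :=
  StrictPseudofunctor.mk'' {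
    obj X := X.base
    map f := f.base
    map₂ δ := δ.base
    map₂_id _ := rfl
    map₂_comp _ _ := rfl
    map_id _ := rfl
    map_comp _ _ := rfl
    map₂_whisker_left f _ _ η :=
      ((Category.id_comp _).trans (Category.comp_id (f.base ◁ η.base))).symm
    map₂_whisker_right η f :=
      ((Category.id_comp _).trans (Category.comp_id (η.base ▷ f.base))).symm }

section Map

variable {G H : StrictPseudofunctor A Cat.{t, t}}

variable (φ : Lax.LaxTrans F.toLax G.toLax)

theorem eq_conj {f f' g g' : X ⟶ Y} (h : f' = f) (h' : g = g') (δ : f ⟶ g) (δ' : f' ⟶ g')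
    (w : HEq δ'.base δ.base) : δ' = eqToHom h ≫ δ ≫ eqToHom h' := by
  subst h h'
  simpa using hom₂_ext (eq_of_heq w)

/-- The 2-functor between 2-categories of elements induced by a lax transformation `φ`:
`(B, X) ↦ (B, φ_B X)`, `(f, α) ↦ (f, φ_C α ∘ (φ_f)_X)`, `δ ↦ δ`. -/
def map : StrictPseudofunctor (Elements F) (Elements G) :=
  StrictPseudofunctor.mk'' {
    obj := mapObj φ
    map := mapHom φ
    map₂ := mapHom₂ φ
    map₂_id _ := rfl
    map₂_comp _ _ := rfl
    map_id := mapHom_id φ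
    map_comp := mapHom_comp φ
    map₂_whisker_left _ _ _ _ := eq_conj _ _ _ _ HEq.rfl
    map₂_whisker_right _ _ := eq_conj _ _ _ _ HEq.rfl }

theorem map_comp_proj : (map φ).comp (proj G) = proj F :=
  twoFunctor_ext rfl

theorem hom₂_heq {f f' g g' : X ⟶ Y} (h : f = f') (h' : g = g') (δ : f ⟶ g) (δ' : f' ⟶ g')
    (w : HEq δ.base δ'.base) : HEq δ δ' := by
  subst h h'
  exact heq_of_eq (hom₂_ext (eq_of_heq w))

theorem twoFunctor_ext_heq {B : Type*} [Bicategory B] {C : Type*} [Bicategory C]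
    {K L : StrictPseudofunctor B C}
    (h : ∀ x, K.obj x = L.obj x) (h₁ : ∀ {x y : B} (f : x ⟶ y), HEq (K.map f) (L.map f))
    (h₂ : ∀ {x y : B} {f g : x ⟶ y} (δ : f ⟶ g), HEq (K.map₂ δ) (L.map₂ δ)) : K = L := by
  apply twoFunctor_ext
  obtain ⟨⟨⟨⟨⟨⟨oK, mK⟩, m₂K⟩, _, _⟩, _, _, _, _, _, _, _⟩, _, _⟩, _, _⟩ := K
  obtain ⟨⟨⟨⟨⟨⟨oL, mL⟩, m₂L⟩, _, _⟩, _, _, _, _, _, _, _⟩, _, _⟩, _, _⟩ := L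
  dsimp at h h₁ h₂ ⊢
  obtain rfl : oK = oL := funext h
  have e₁ : @mK = @mL := by
    funext x y f
    exact eq_of_heq (h₁ f)
  subst e₁
  have e₂ : @m₂K = @m₂L := by
    funext x y f g δ
    exact eq_of_heq (h₂ δ)
  subst e₂
  rfl

theorem mapHom_id_lax {X Y : Elements F} (f : X ⟶ Y) : mapHom (𝟙 F.toLax) f = f :=
  Hom.ext rfl (heq_of_eq (by
    change (𝟙 _ ≫ 𝟙 _) ≫ f.fiber = f.fiber
    simp))

theorem mapHom_comp_lax (ψ : Lax.LaxTrans G.toLax H.toLax) {X Y : Elements F} (f : X ⟶ Y) :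
    mapHom (φ.vComp ψ) f = mapHom ψ (mapHom φ f) :=
  Hom.ext rfl (heq_of_eq (by
    change (𝟙 _ ≫ laxStr ψ f.base ((laxApp φ X.base).obj X.fiber) ≫ 𝟙 _ ≫
      (laxApp ψ Y.base).map (laxStr φ f.base X.fiber) ≫ 𝟙 _) ≫
        (laxApp ψ Y.base).map ((laxApp φ Y.base).map f.fiber) =
      laxStr ψ f.base ((laxApp φ X.base).obj X.fiber) ≫
        (laxApp ψ Y.base).map (laxStr φ f.base X.fiber ≫ (laxApp φ Y.base).map f.fiber)
    simp))

theorem map_id_lax : map (𝟙 F.toLax) = StrictPseudofunctor.id (Elements F) :=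
  twoFunctor_ext_heq (fun _ => rfl) (fun f => heq_of_eq (mapHom_id_lax f))
    fun _ => hom₂_heq (mapHom_id_lax _) (mapHom_id_lax _) _ _ HEq.rfl

theorem map_comp_lax (ψ : Lax.LaxTrans G.toLax H.toLax) :
    map (φ.vComp ψ) = (map φ).comp (map ψ) :=
  twoFunctor_ext_heq (fun _ => rfl) (fun f => heq_of_eq (mapHom_comp_lax φ ψ f))
    fun _ => hom₂_heq (mapHom_comp_lax φ ψ _) (mapHom_comp_lax φ ψ _) _ _ HEq.rfl

/-- The vertical 1-cell `(id_B, α)`. -/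
def vert {B : A} {x y : F.obj B} (α : x ⟶ y) : (Elements.mk B x : Elements F) ⟶ ⟨B, y⟩ :=
  Hom.mk (𝟙 B) ((F.mapId B).hom.toNatTrans.app x ≫ α)

theorem mk_comp_vert {B C : A} {x : F.obj B} {y y' : F.obj C} (f : B ⟶ C)
    (a : (F.map f).toFunctor.obj x ⟶ y) (β : y ⟶ y') :
    (Hom.mk f a : (Elements.mk B x : Elements F) ⟶ ⟨C, y⟩) ≫ vert β = Hom.mk f (a ≫ β) := by
  refine eq_of_hom₂ (Hom₂.mk (ρ_ f).hom ?_) (Strict.comp_id f)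
    (congrArg Iso.hom (Strict.rightUnitor_eqToIso f))
  have h := congrArg (fun α => α.toNatTrans.app x) (F.map₂_right_unitor f)
  dsimp at h
  dsimp [vert]
  rw [h]
  have h' := (F.mapId C).hom.toNatTrans.naturality a
  dsimp at h'
  rw [reassoc_of% h']
  simp

theorem vert_comp_mk {B C : A} {x x' : F.obj B} {y : F.obj C} (α : x ⟶ x') (f : B ⟶ C)
    (b : (F.map f).toFunctor.obj x' ⟶ y) :
    vert α ≫ (Hom.mk f b : (Elements.mk B x' : Elements F) ⟶ ⟨C, y⟩) =
      Hom.mk f ((F.map f).toFunctor.map α ≫ b) := by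
  refine eq_of_hom₂ (Hom₂.mk (λ_ f).hom ?_) (Strict.id_comp f)
    (congrArg Iso.hom (Strict.leftUnitor_eqToIso f))
  have h := congrArg (fun α => α.toNatTrans.app x) (F.map₂_left_unitor f)
  dsimp at h
  dsimp [vert]
  rw [h]
  simp

theorem vert_comp {B : A} {x y z : F.obj B} (α : x ⟶ y) (β : y ⟶ z) :
    vert α ≫ vert β = vert (α ≫ β) := by
  refine (mk_comp_vert _ _ β).trans ?_
  rw [Category.assoc]
  rfl

theorem vert_id {B : A} (x : F.obj B) : vert (𝟙 x) = 𝟙 (Elements.mk B x : Elements F) :=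
  Hom.ext rfl (heq_of_eq (Category.comp_id _))

theorem mapHom_vert {B : A} {x y : F.obj B} (α : x ⟶ y) :
    mapHom φ (vert α) = vert ((laxApp φ B).map α) :=
  Hom.ext rfl (heq_of_eq (by
    change laxStr φ (𝟙 B) x ≫ (laxApp φ B).map ((F.mapId B).hom.toNatTrans.app x ≫ α) = _ ≫ _
    rw [Functor.map_comp, ← Category.assoc, laxStr_id]))

theorem vert_naturality {B C : A} {x x' : F.obj B} {y y' : F.obj C} (α : x ⟶ x') (β : y ⟶ y')
    (f : B ⟶ C) (a : (F.map f).toFunctor.obj x ⟶ y) (b : (F.map f).toFunctor.obj x' ⟶ y')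
    (h : a ≫ β = (F.map f).toFunctor.map α ≫ b) :
    (Hom.mk f a : (Elements.mk B x : Elements F) ⟶ ⟨C, y⟩) ≫ vert β =
      vert α ≫ (Hom.mk f b : (Elements.mk B x' : Elements F) ⟶ ⟨C, y'⟩) := by
  rw [mk_comp_vert, vert_comp_mk, h]

end Map

end Elements

end Elements

section Fibrations

variable {C : Type u₁} [Category.{v₁} C] {D : Type u₂} [Category.{v₂} D]

/-- A discrete fibration: every morphism with codomain `p y` has a unique lift with
codomain `y`. -/
def IsDiscreteFibration (p : C ⥤ D) : Prop :=
  ∀ (y : C) {d : D} (f : d ⟶ p.obj y), ∃! x : (Σ x : C, x ⟶ y), p.IsHomLift f x.2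

/-- A splitting of `p`, which makes `p` a split Grothendieck opfibration: a choice of a
cocartesian lift of every `f : p x ⟶ b` with domain `x`, closed under identities and composition.
The choice is given by the class of all chosen lifts. -/
structure Splitting (p : C ⥤ D) where
  chosen : MorphismProperty C
  cocartesian {x y : C} (φ : x ⟶ y) : chosen φ → p.IsStronglyCocartesian (p.map φ) φ
  existsUnique_lift (x : C) {b : D} (f : p.obj x ⟶ b) :
    ∃! y : (Σ y : C, x ⟶ y), p.IsHomLift f y.2 ∧ chosen y.2
  id_mem (x : C) : chosen (𝟙 x)
  comp_mem {x y z : C} (φ : x ⟶ y) (ψ : y ⟶ z) : chosen φ → chosen ψ → chosen (φ ≫ ψ)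

theorem isHomLift_iff_codomain (p : C ⥤ D) {x y : C} {d : D} (f : d ⟶ p.obj y) (φ : x ⟶ y) :
    p.IsHomLift f φ ↔ ∃ h : d = p.obj x, f = eqToHom h ≫ p.map φ := by
  constructor
  · intro h
    exact ⟨(IsHomLift.domain_eq p f φ).symm, by simpa using IsHomLift.fac p f φ⟩
  · rintro ⟨rfl, rfl⟩
    rw [eqToHom_refl, Category.id_comp]
    infer_instance

theorem isHomLift_iff_domain (p : C ⥤ D) {x y : C} {d : D} (f : p.obj x ⟶ d) (φ : x ⟶ y) :
    p.IsHomLift f φ ↔ ∃ h : p.obj y = d, f = p.map φ ≫ eqToHom h := by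
  constructor
  · intro h
    exact ⟨IsHomLift.codomain_eq p f φ, by simpa using IsHomLift.fac p f φ⟩
  · rintro ⟨rfl, rfl⟩
    rw [eqToHom_refl, Category.comp_id]
    infer_instance

end Fibrations

namespace Elements

variable {A : Type u} [Bicategory.{w, v} A] [Strict A]
variable {F G : StrictPseudofunctor A Cat.{t, t}}

section

def mapTransApp {φ ψ : F.toLax ⟶ G.toLax} (Θ : φ ⟶ ψ) (X : Elements F) :
    mapObj φ X ⟶ mapObj ψ X :=
  vert (modApp Θ X.base X.fiber)

theorem mapTrans_aux {φ ψ : F.toLax ⟶ G.toLax} (Θ : φ ⟶ ψ) {X Y : Elements F} (f : X ⟶ Y) :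
    (laxStr φ f.base X.fiber ≫ (laxApp φ Y.base).map f.fiber) ≫ modApp Θ Y.base Y.fiber =
      (G.map f.base).toFunctor.map (modApp Θ X.base X.fiber) ≫
        laxStr ψ f.base X.fiber ≫ (laxApp ψ Y.base).map f.fiber := by
  rw [Category.assoc, modApp_naturality, ← Category.assoc, ← modApp_laxStr, Category.assoc]

theorem mapTrans_naturality {φ ψ : F.toLax ⟶ G.toLax} (Θ : φ ⟶ ψ) {X Y : Elements F}
    (f : X ⟶ Y) : mapHom φ f ≫ mapTransApp Θ Y = mapTransApp Θ X ≫ mapHom ψ f :=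
  vert_naturality _ _ _ _ _ (mapTrans_aux Θ f)

theorem eqToHom_square {B : Type*} [Category B] {a b c d : B} (h : b = d) (h' : a = c)
    (p : a ⟶ b) (q : c ⟶ d) (w : HEq p q) : p ≫ eqToHom h = eqToHom h' ≫ q := by
  subst h h'
  simpa using w

theorem whiskerRight_id_heq {a b : A} {f g : a ⟶ b} (η : f ⟶ g) : HEq (η ▷ 𝟙 b) η := by
  rw [Bicategory.whiskerRight_id, Strict.rightUnitor_eqToIso, Strict.rightUnitor_eqToIso]
  simp

theorem id_whiskerLeft_heq {a b : A} {f g : a ⟶ b} (η : f ⟶ g) : HEq (𝟙 a ◁ η) η := by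
  rw [Bicategory.id_whiskerLeft, Strict.leftUnitor_eqToIso, Strict.leftUnitor_eqToIso]
  simp

/-- The 2-natural transformation between 2-categories of elements induced by a modification
`Θ`, with components `(id_B, Θ_{B, X})`. -/
def mapTrans {φ ψ : F.toLax ⟶ G.toLax} (Θ : φ ⟶ ψ) : TwoNatTrans (map φ) (map ψ) where
  app := mapTransApp Θ
  naturality f := mapTrans_naturality Θ f
  naturality₂ {_ _ f g} δ :=
    eqToHom_square _ _ _ _ (hom₂_heq (mapTrans_naturality Θ f) (mapTrans_naturality Θ g) _ _
      ((whiskerRight_id_heq δ.base).trans (id_whiskerLeft_heq δ.base).symm))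

end

variable (F)

theorem proj_locallyDiscrete (X Y : Elements F) :
    IsDiscreteFibration ((proj F).mapFunctor X Y) := by
  intro g d δ
  refine ⟨⟨Hom.mk d ((F.map₂ δ).toNatTrans.app X.fiber ≫ g.fiber), Hom₂.mk δ rfl⟩, ?_, ?_⟩
  · exact (isHomLift_iff_codomain _ _ _).2 ⟨rfl, (Category.id_comp _).symm⟩
  · rintro ⟨f, κ⟩ h
    obtain ⟨h, h'⟩ := (isHomLift_iff_codomain _ _ _).1 h
    obtain ⟨f, α⟩ := f
    change d = f at h
    subst h
    obtain ⟨κ, hκ⟩ := κ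
    obtain rfl : δ = κ := h'.trans (Category.id_comp _)
    dsimp at hκ
    subst hκ
    rfl

/-- The chosen lifts in the 2-category of elements are the 1-cells `(f, id)`. -/
def chosen : MorphismProperty (Elements F) := fun X Y f =>
  ∃ h : (F.map f.base).toFunctor.obj X.fiber = Y.fiber, f.fiber = eqToHom h

variable {F} in
theorem chosen_rec {P : ∀ X Y : Elements F, (X ⟶ Y) → Prop}
    (h : ∀ (B C : A) (f : B ⟶ C) (x : F.obj B),
      P ⟨B, x⟩ ⟨C, (F.map f).toFunctor.obj x⟩ (Hom.mk f (𝟙 _)))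
    {X Y : Elements F} (f : X ⟶ Y) (hf : chosen F f) : P X Y f := by
  have key : ∀ (B C : A) (f : B ⟶ C) (x : F.obj B) (y : F.obj C)
      (α : (F.map f).toFunctor.obj x ⟶ y) (e : (F.map f).toFunctor.obj x = y),
      α = eqToHom e → P ⟨B, x⟩ ⟨C, y⟩ (Hom.mk f α) := by
    rintro B C f x _ _ rfl rfl
    exact h B C f x
  obtain ⟨e, he⟩ := hf
  exact key _ _ f.base X.fiber Y.fiber f.fiber e he

variable {F} in
theorem mk_comp_mk {B C D : A} (f : B ⟶ C) (x : F.obj B) (g : C ⟶ D) (z : F.obj D)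
    (β : (F.map g).toFunctor.obj ((F.map f).toFunctor.obj x) ⟶ z) :
    @CategoryStruct.comp (Elements F) _ ⟨B, x⟩ ⟨C, (F.map f).toFunctor.obj x⟩ ⟨D, z⟩
        (Hom.mk f (𝟙 _)) (Hom.mk g β) =
      Hom.mk (f ≫ g) ((F.mapComp f g).hom.toNatTrans.app x ≫ β) := by
  refine Hom.ext rfl (heq_of_eq ?_)
  change _ ≫ (F.map g).toFunctor.map (𝟙 _) ≫ β = _ ≫ β
  simp

variable {F} in
theorem lift_fac {B C D : A} (f : B ⟶ C) (x : F.obj B) (g : C ⟶ D) (z : F.obj D)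
    (β : (F.map (f ≫ g)).toFunctor.obj x ⟶ z) :
    @CategoryStruct.comp (Elements F) _ ⟨B, x⟩ ⟨C, (F.map f).toFunctor.obj x⟩ ⟨D, z⟩
        (Hom.mk f (𝟙 _)) (Hom.mk g ((F.mapComp f g).inv.toNatTrans.app x ≫ β)) =
      Hom.mk (f ≫ g) β := by
  refine (mk_comp_mk f x g z _).trans (Hom.ext rfl (heq_of_eq ?_))
  change _ ≫ _ ≫ β = β
  simp

variable {F} in
theorem lift_unique {B C D : A} (f : B ⟶ C) (x : F.obj B) (g : C ⟶ D) (z : F.obj D)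
    (β : (F.map (f ≫ g)).toFunctor.obj x ⟶ z)
    (β' : (F.map g).toFunctor.obj ((F.map f).toFunctor.obj x) ⟶ z)
    (h : @CategoryStruct.comp (Elements F) _ ⟨B, x⟩ ⟨C, (F.map f).toFunctor.obj x⟩ ⟨D, z⟩
        (Hom.mk f (𝟙 _)) (Hom.mk g β') = Hom.mk (f ≫ g) β) :
    β' = (F.mapComp f g).inv.toNatTrans.app x ≫ β := by
  rw [mk_comp_mk] at h
  injection h with _ h
  rw [← h]
  simp

theorem chosen_cocartesian {X Y : Elements F} (f : X ⟶ Y) (hf : chosen F f) :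
    (proj F).toFunctor.IsStronglyCocartesian ((proj F).toFunctor.map f) f := by
  refine chosen_rec (P := fun _ _ f =>
    (proj F).toFunctor.IsStronglyCocartesian ((proj F).toFunctor.map f) f) ?_ f hf
  intro B C f x
  refine ⟨?_⟩
  rintro ⟨D, z⟩ g ⟨k, β⟩ hk
  have hk' : f ≫ g = k := @IsHomLift.eq_of_isHomLift _ _ _ _ (proj F).toFunctor _ _ _ _ hk
  subst hk'
  refine ⟨Hom.mk g ((F.mapComp f g).inv.toNatTrans.app x ≫ β), ⟨?_, ?_⟩, ?_⟩
  · exact IsHomLift.map (p := (proj F).toFunctor)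
      (Hom.mk g _ : (⟨C, (F.map f).toFunctor.obj x⟩ : Elements F) ⟶ ⟨D, z⟩)
  · exact lift_fac f x g z β
  · rintro ⟨g', β'⟩ ⟨h₁, h₂⟩
    have hg : g = g' := @IsHomLift.eq_of_isHomLift _ _ _ _ (proj F).toFunctor _ _ _ _ h₁
    subst hg
    exact Hom.ext rfl (heq_of_eq (lift_unique f x g z β β' h₂))

/-- The canonical splitting of the 2-category of elements. -/
def splitting : Splitting (proj F).toFunctor where
  chosen := chosen F
  cocartesian := chosen_cocartesian F
  existsUnique_lift X b f := by
    refine ⟨⟨⟨b, (F.map f).toFunctor.obj X.fiber⟩, Hom.mk f (𝟙 _)⟩, ⟨?_, rfl, rfl⟩, ?_⟩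
    · exact (isHomLift_iff_domain _ _ _).2 ⟨rfl, (Category.comp_id _).symm⟩
    · rintro ⟨Y, g⟩ ⟨h, hg⟩
      refine chosen_rec (P := fun X Y g => ∀ {b : A} (f : X.base ⟶ b),
        (proj F).toFunctor.IsHomLift f g → (⟨Y, g⟩ : Σ Y : Elements F, X ⟶ Y) =
          ⟨⟨b, (F.map f).toFunctor.obj X.fiber⟩, Hom.mk f (𝟙 _)⟩) ?_ g hg f h
      intro B C g x b f h
      obtain ⟨h, h'⟩ := (isHomLift_iff_domain _ _ _).1 h
      change C = b at h
      subst h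
      obtain rfl : f = g := h'.trans (Category.comp_id _)
      rfl
  id_mem X := ⟨_, mapId_app X.base X.fiber⟩
  comp_mem := by
    rintro X Y Z f g ⟨hf, hf'⟩ ⟨hg, hg'⟩
    refine ⟨?_, ?_⟩
    · rw [← hg, ← hf, comp_base, F.map_comp]
      rfl
    · rw [comp_fiber, hf', hg', mapComp_app, eqToHom_map, eqToHom_trans, eqToHom_trans]

/-- The object of the fibre over `a` given by `x` in `F a`. -/
def fiberMk {a : A} (x : F.obj a) : (proj F).toFunctor.Fiber a := ⟨⟨a, x⟩, rfl⟩

instance (a : A) : Small.{t} ((proj F).toFunctor.Fiber a) :=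
  small_of_surjective (f := fiberMk F (a := a)) (by
    rintro ⟨⟨B, x⟩, h⟩
    obtain rfl : B = a := h
    exact ⟨x, rfl⟩)

instance (a : A) : LocallySmall.{t} ((proj F).toFunctor.Fiber a) where
  hom_small x y := by
    obtain ⟨⟨B, x⟩, hx⟩ := x
    obtain rfl : B = a := hx
    obtain ⟨⟨C, y⟩, hy⟩ := y
    obtain rfl : C = B := hy
    refine small_of_surjective (f := fun α : x ⟶ y =>
      (⟨vert α, IsHomLift.map (p := (proj F).toFunctor) (vert α)⟩ :
        fiberMk F x ⟶ fiberMk F y)) ?_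
    rintro ⟨⟨f, β⟩, h⟩
    have hf : 𝟙 C = f := @IsHomLift.eq_of_isHomLift _ _ _ _ (proj F).toFunctor _ _ _ _ h
    subst hf
    refine ⟨(F.mapId C).inv.toNatTrans.app x ≫ β, Subtype.ext (Hom.ext rfl (heq_of_eq ?_))⟩
    change (F.mapId C).hom.toNatTrans.app x ≫ (F.mapId C).inv.toNatTrans.app x ≫ β = β
    simp

end Elements

section TwoEquivalences

variable {B : Type u₁} [Bicategory.{w₁, v₁} B] {C : Type u₂} [Bicategory.{w₂, v₂} C]

/-- A property of 1-cells that holds for identities and is closed under composition. -/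
structure OneCellProperty (B : Type u₁) [Bicategory.{w₁, v₁} B] where
  holds {x y : B} (f : x ⟶ y) : Prop
  id_mem (x : B) : holds (𝟙 x)
  comp_mem {x y z : B} (f : x ⟶ y) (g : y ⟶ z) : holds f → holds g → holds (f ≫ g)

/-- The locally full sub-2-category on all objects, the 1-cells satisfying `W`, and all 2-cells
between them. -/
structure WideSub (W : OneCellProperty B) where
  obj : B

namespace WideSub

variable {W : OneCellProperty B} {V : OneCellProperty C}

@[ext]
structure Hom (X Y : WideSub W) where
  hom : X.obj ⟶ Y.obj
  property : W.holds hom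

@[ext]
structure Hom₂ {X Y : WideSub W} (f g : Hom X Y) where
  hom : f.hom ⟶ g.hom

instance : CategoryStruct (WideSub W) where
  Hom X Y := Hom X Y
  id X := ⟨𝟙 X.obj, W.id_mem _⟩
  comp f g := ⟨f.hom ≫ g.hom, W.comp_mem _ _ f.property g.property⟩

instance (X Y : WideSub W) : Category (X ⟶ Y) where
  Hom f g := Hom₂ f g
  id f := ⟨𝟙 f.hom⟩
  comp η θ := ⟨η.hom ≫ θ.hom⟩
  id_comp _ := Hom₂.ext (Category.id_comp _)
  comp_id _ := Hom₂.ext (Category.comp_id _)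
  assoc _ _ _ := Hom₂.ext (Category.assoc _ _ _)

theorem hom_ext {X Y : WideSub W} {f g : X ⟶ Y} (h : f.hom = g.hom) : f = g := Hom.ext h

theorem hom₂_ext {X Y : WideSub W} {f g : X ⟶ Y} {η θ : f ⟶ g} (h : η.hom = θ.hom) : η = θ :=
  Hom₂.ext h

def isoMk {X Y : WideSub W} {f g : X ⟶ Y} (e : f.hom ≅ g.hom) : f ≅ g where
  hom := Hom₂.mk e.hom
  inv := Hom₂.mk e.inv
  hom_inv_id := hom₂_ext e.hom_inv_id
  inv_hom_id := hom₂_ext e.inv_hom_id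

def whiskerLeft {X Y Z : WideSub W} (f : X ⟶ Y) {g h : Y ⟶ Z} (η : g ⟶ h) :
    f ≫ g ⟶ f ≫ h :=
  Hom₂.mk (f.hom ◁ η.hom)

def whiskerRight {X Y Z : WideSub W} {f g : X ⟶ Y} (η : f ⟶ g) (h : Y ⟶ Z) :
    f ≫ h ⟶ g ≫ h :=
  Hom₂.mk (η.hom ▷ h.hom)

instance : Bicategory (WideSub W) where
  whiskerLeft f _ _ η := whiskerLeft f η
  whiskerRight η h := whiskerRight η h
  associator f g h := isoMk (α_ f.hom g.hom h.hom)
  leftUnitor f := isoMk (λ_ f.hom)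
  rightUnitor f := isoMk (ρ_ f.hom)
  whiskerLeft_id _ _ := hom₂_ext (Bicategory.whiskerLeft_id _ _)
  whiskerLeft_comp _ _ _ _ _ _ := hom₂_ext (Bicategory.whiskerLeft_comp _ _ _)
  id_whiskerLeft _ := hom₂_ext (Bicategory.id_whiskerLeft _)
  comp_whiskerLeft _ _ _ _ _ := hom₂_ext (Bicategory.comp_whiskerLeft _ _ _)
  id_whiskerRight _ _ := hom₂_ext (Bicategory.id_whiskerRight _ _)
  comp_whiskerRight _ _ _ := hom₂_ext (Bicategory.comp_whiskerRight _ _ _)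
  whiskerRight_id _ := hom₂_ext (Bicategory.whiskerRight_id _)
  whiskerRight_comp _ _ _ := hom₂_ext (Bicategory.whiskerRight_comp _ _ _)
  whisker_assoc _ _ _ _ _ := hom₂_ext (Bicategory.whisker_assoc _ _ _)
  whisker_exchange _ _ := hom₂_ext (Bicategory.whisker_exchange _ _)
  pentagon _ _ _ _ := hom₂_ext (Bicategory.pentagon _ _ _ _)
  triangle _ _ := hom₂_ext (Bicategory.triangle _ _)

theorem eqToHom_hom {X Y : WideSub W} {f g : X ⟶ Y} (h : f = g) :
    (eqToHom h).hom = eqToHom (by rw [h]) := by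
  subst h
  rfl

theorem iso_eq {X Y : WideSub W} {f g : X ⟶ Y} (i : f ≅ g) (h : f = g)
    (w : i.hom.hom = eqToHom (by rw [h])) : i = eqToIso h :=
  Iso.ext (hom₂_ext (w.trans (eqToHom_hom h).symm))

instance [Strict B] : Strict (WideSub W) where
  id_comp f := Hom.ext (Strict.id_comp f.hom)
  comp_id f := Hom.ext (Strict.comp_id f.hom)
  assoc f g h := Hom.ext (Strict.assoc f.hom g.hom h.hom)
  leftUnitor_eqToIso f := iso_eq _ _ (congrArg Iso.hom (Strict.leftUnitor_eqToIso f.hom))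
  rightUnitor_eqToIso f := iso_eq _ _ (congrArg Iso.hom (Strict.rightUnitor_eqToIso f.hom))
  associator_eqToIso f g h :=
    iso_eq _ _ (congrArg Iso.hom (Strict.associator_eqToIso f.hom g.hom h.hom))

theorem eq_conj {X Y : WideSub W} {f f' g g' : X ⟶ Y} (h : f' = f) (h' : g = g')
    (δ : f ⟶ g) (δ' : f' ⟶ g')
    (w : δ'.hom = eqToHom (by rw [h]) ≫ δ.hom ≫ eqToHom (by rw [h'])) :
    δ' = eqToHom h ≫ δ ≫ eqToHom h' := by
  subst h h'
  refine hom₂_ext (w.trans ?_)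
  simp only [eqToHom_refl, Category.id_comp, Category.comp_id]

section Restrict

variable (Φ : StrictPseudofunctor B C)
  (h : ∀ {x y : B} (f : x ⟶ y), W.holds f → V.holds (Φ.map f))

def restrictObj (X : WideSub W) : WideSub V := ⟨Φ.obj X.obj⟩

theorem map₂_whiskerLeft {x y z : B} (f : x ⟶ y) {g g' : y ⟶ z} (η : g ⟶ g') :
    Φ.map₂ (f ◁ η) = eqToHom (Φ.map_comp f g) ≫ Φ.map f ◁ Φ.map₂ η ≫
      eqToHom (Φ.map_comp f g').symm := by
  rw [Φ.map₂_whisker_left, Φ.mapComp_eq_eqToIso, Φ.mapComp_eq_eqToIso]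
  rfl

theorem map₂_whiskerRight {x y z : B} {f f' : x ⟶ y} (η : f ⟶ f') (g : y ⟶ z) :
    Φ.map₂ (η ▷ g) = eqToHom (Φ.map_comp f g) ≫ Φ.map₂ η ▷ Φ.map g ≫
      eqToHom (Φ.map_comp f' g).symm := by
  rw [Φ.map₂_whisker_right, Φ.mapComp_eq_eqToIso, Φ.mapComp_eq_eqToIso]
  rfl

variable {Φ}

def restrictMap {X Y : WideSub W} (f : X ⟶ Y) :
    (restrictObj Φ X : WideSub V) ⟶ restrictObj Φ Y :=
  Hom.mk (Φ.map f.hom) (h _ f.property)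

def restrictMap₂ {X Y : WideSub W} {f g : X ⟶ Y} (η : f ⟶ g) :
    restrictMap h f ⟶ restrictMap h g :=
  Hom₂.mk (Φ.map₂ η.hom)

variable [Strict B] [Strict C]

variable (Φ) in
/-- The restriction of a 2-functor to locally full sub-2-categories. -/
def restrict : StrictPseudofunctor (WideSub W) (WideSub V) :=
  StrictPseudofunctor.mk'' {
    obj := restrictObj Φ
    map := restrictMap h
    map₂ := restrictMap₂ h
    map₂_id f := Hom₂.ext (Φ.map₂_id f.hom)
    map₂_comp η θ := Hom₂.ext (Φ.map₂_comp η.hom θ.hom)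
    map_id X := Hom.ext (Φ.map_id X.obj)
    map_comp f g := Hom.ext (Φ.map_comp f.hom g.hom)
    map₂_whisker_left f _ _ η := eq_conj _ _ _ _ (map₂_whiskerLeft Φ f.hom η.hom)
    map₂_whisker_right η f := eq_conj _ _ _ _ (map₂_whiskerRight Φ η.hom f.hom) }

end Restrict

end WideSub

/-- A 2-functor is a 2-equivalence when it is 2-fully faithful (an isomorphism on each
hom-category, i.e. bijective on 1-cells and on 2-cells) and essentially surjective on objects
(every object of the target is isomorphic to one in the image). -/
structure IsTwoEquivalence (Φ : StrictPseudofunctor B C) : Prop where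
  bijective_map (x y : B) : Function.Bijective fun f : x ⟶ y => Φ.map f
  bijective_map₂ {x y : B} (f g : x ⟶ y) : Function.Bijective fun η : f ⟶ g => Φ.map₂ η
  essSurj (c : C) :
    ∃ (b : B) (f : Φ.obj b ⟶ c) (g : c ⟶ Φ.obj b), f ≫ g = 𝟙 (Φ.obj b) ∧ g ≫ f = 𝟙 c

end TwoEquivalences

section Main

variable (A : Type u) [Bicategory.{w, v} A] [Strict A]

set_option linter.checkUnivs false in
/-- A split discrete 2-opfibration over `A` with small fibres: a 2-functor to `A` that is locally
a discrete fibration, whose underlying functor is a split Grothendieck opfibration, and whose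
fibre categories are small. -/
structure SplitDiscreteTwoOpfibration where
  toOver : TwoCatOver.{w, w, v, max v t, u, max u t} A
  locallyDiscrete (x y : toOver.carrier) : IsDiscreteFibration (toOver.proj.mapFunctor x y)
  splitting : Splitting toOver.proj.toFunctor
  small_fiber (a : A) : Small.{t} (toOver.proj.toFunctor.Fiber a)
  locallySmall_fiber (a : A) : LocallySmall.{t} (toOver.proj.toFunctor.Fiber a)

/-- The full sub-2-category of `2-Cat / A` on the split discrete 2-opfibrations with small
fibres. -/
abbrev Fib :=
  InducedBicategory (TwoCatOver.{w, w, v, max v t, u, max u t} A)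
    (SplitDiscreteTwoOpfibration.toOver (A := A))

/-- The 2-category of 2-functors `A → Cat`, lax natural transformations and modifications. -/
abbrev LaxCopresheaf :=
  InducedBicategory (A ⥤ᴸ Cat.{t, t}) (fun F : StrictPseudofunctor A Cat.{t, t} => F.toLax)

variable {A}

/-- `∫F` as an object of `Fib(A)`, with its canonical splitting. -/
def elementsObj (F : StrictPseudofunctor A Cat.{t, t}) :
    SplitDiscreteTwoOpfibration.{w, v, u, t} A where
  toOver := { carrier := Elements F, proj := Elements.proj F }
  locallyDiscrete := Elements.proj_locallyDiscrete F
  splitting := Elements.splitting F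
  small_fiber _ := inferInstance
  locallySmall_fiber _ := inferInstance

def elementsMap {F G : StrictPseudofunctor A Cat.{t, t}} (φ : F.toLax ⟶ G.toLax) :
    (elementsObj F).toOver ⟶ (elementsObj G).toOver :=
  TwoCatOver.Hom.mk (Elements.map φ) (Elements.map_comp_proj φ)

def elementsMap₂ {F G : StrictPseudofunctor A Cat.{t, t}} {φ ψ : F.toLax ⟶ G.toLax} (Θ : φ ⟶ ψ) :
    elementsMap φ ⟶ elementsMap ψ :=
  TwoCatOver.Hom₂.mk (Elements.mapTrans Θ) fun X =>
    Functor.IsHomLift.map (p := (Elements.proj G).toFunctor) (Elements.mapTransApp Θ X)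

theorem elementsMap_id (F : StrictPseudofunctor A Cat.{t, t}) :
    elementsMap (𝟙 F.toLax) = 𝟙 (elementsObj F).toOver :=
  TwoCatOver.hom_ext Elements.map_id_lax

theorem elementsMap_comp {F G H : StrictPseudofunctor A Cat.{t, t}} (φ : F.toLax ⟶ G.toLax)
    (ψ : G.toLax ⟶ H.toLax) : elementsMap (φ ≫ ψ) = elementsMap φ ≫ elementsMap ψ :=
  TwoCatOver.hom_ext (Elements.map_comp_lax φ ψ)

theorem elementsMap₂_id {F G : StrictPseudofunctor A Cat.{t, t}} (φ : F.toLax ⟶ G.toLax) :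
    elementsMap₂ (𝟙 φ) = 𝟙 (elementsMap φ) :=
  TwoCatOver.hom₂_ext fun _ => Elements.vert_id _

theorem elementsMap₂_comp {F G : StrictPseudofunctor A Cat.{t, t}} {φ ψ χ : F.toLax ⟶ G.toLax}
    (Θ : φ ⟶ ψ) (Ξ : ψ ⟶ χ) : elementsMap₂ (Θ ≫ Ξ) = elementsMap₂ Θ ≫ elementsMap₂ Ξ :=
  TwoCatOver.hom₂_ext fun _ => (Elements.vert_comp _ _).symm

theorem elementsMap₂_whiskerLeft {F G H : StrictPseudofunctor A Cat.{t, t}}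
    (φ : F.toLax ⟶ G.toLax) {ψ χ : G.toLax ⟶ H.toLax} (Θ : ψ ⟶ χ) :
    elementsMap₂ (φ ◁ Θ) = eqToHom (elementsMap_comp φ ψ) ≫ elementsMap φ ◁ elementsMap₂ Θ ≫
      eqToHom (elementsMap_comp φ χ).symm :=
  TwoCatOver.conj_eqToHom _ _ _ _ fun _ => TwoCatOver.conj_id _

theorem elementsMap₂_whiskerRight {F G H : StrictPseudofunctor A Cat.{t, t}}
    {φ ψ : F.toLax ⟶ G.toLax} (Θ : φ ⟶ ψ) (χ : G.toLax ⟶ H.toLax) :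
    elementsMap₂ (Θ ▷ χ) = eqToHom (elementsMap_comp φ χ) ≫ elementsMap₂ Θ ▷ elementsMap χ ≫
      eqToHom (elementsMap_comp ψ χ).symm :=
  TwoCatOver.conj_eqToHom _ _ _ _ fun X =>
    (Elements.mapHom_vert χ (Elements.modApp Θ X.base X.fiber)).symm.trans
      (TwoCatOver.conj_id (X := (elementsObj H).toOver)
        (Elements.mapHom χ (Elements.mapTransApp Θ X)))

theorem induced_eq_conj {B : Type u₁} {C : Type u₂} [Bicategory.{w₂, v₂} C] {F : B → C}
    {X Y : InducedBicategory C F} {f f' g g' : X ⟶ Y} (h : f' = f) (h' : g = g')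
    (δ : f ⟶ g) (δ' : f' ⟶ g')
    (w : δ'.hom = eqToHom (by rw [h]) ≫ δ.hom ≫ eqToHom (by rw [h'])) :
    δ' = eqToHom h ≫ δ ≫ eqToHom h' := by
  subst h h'
  refine InducedBicategory.hom₂_ext (w.trans ?_)
  rw [eqToHom_refl, eqToHom_refl, Category.id_comp, Category.comp_id]
  simp

section

variable {F G : LaxCopresheaf.{w, v, u, t} A}

def elementsHom (φ : F ⟶ G) :
    (show Fib.{w, v, u, t} A from elementsObj F) ⟶ (show Fib.{w, v, u, t} A from elementsObj G) :=
  InducedBicategory.mkHom (elementsMap φ.hom)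

def elementsHom₂ {φ ψ : F ⟶ G} (Θ : φ ⟶ ψ) : elementsHom φ ⟶ elementsHom ψ :=
  InducedBicategory.Hom₂.mk (elementsMap₂ Θ.hom)

end

variable (A) in
/-- The 2-functor `∫ : Lax[A, Cat] → Fib(A)` given by the 2-category of elements. -/
def elements : StrictPseudofunctor (LaxCopresheaf.{w, v, u, t} A) (Fib.{w, v, u, t} A) :=
  StrictPseudofunctor.mk'' {
    obj F := elementsObj F
    map := elementsHom
    map₂ := elementsHom₂
    map₂_id φ := InducedBicategory.hom₂_ext (elementsMap₂_id φ.hom)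
    map₂_comp Θ Ξ := InducedBicategory.hom₂_ext (elementsMap₂_comp Θ.hom Ξ.hom)
    map_id F := InducedBicategory.hom_ext (elementsMap_id F)
    map_comp φ ψ := InducedBicategory.hom_ext (elementsMap_comp φ.hom ψ.hom)
    map₂_whisker_left φ _ _ Θ :=
      induced_eq_conj _ _ _ _ (elementsMap₂_whiskerLeft φ.hom Θ.hom)
    map₂_whisker_right Θ φ :=
      induced_eq_conj _ _ _ _ (elementsMap₂_whiskerRight Θ.hom φ.hom) }

variable (A)

section

variable {C : Type u₂} [Bicategory.{w₂, v₂} C]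

theorem pseudo_comp {x y z x' y' z' : C} {f : x ⟶ x'} {g : y ⟶ y'} {h : z ⟶ z'}
    {p : x ⟶ y} {q : y ⟶ z} {p' : x' ⟶ y'} {q' : y' ⟶ z'}
    (n₁ : p ≫ g ⟶ f ≫ p') (n₂ : q ≫ h ⟶ g ≫ q') (_ : IsIso n₁) (_ : IsIso n₂) :
    IsIso ((α_ p q h).hom ≫ p ◁ n₂ ≫ (α_ p g q').inv ≫ n₁ ▷ q' ≫ (α_ f p' q').hom) := by
  infer_instance

variable [Strict C]

theorem id_naturality {x y : C} (f : x ⟶ y) : (λ_ f).hom ≫ (ρ_ f).inv =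
    eqToHom ((Strict.id_comp f).trans (Strict.comp_id f).symm) := by
  simp [Strict.leftUnitor_eqToIso, Strict.rightUnitor_eqToIso]

theorem strict_comp {x y z x' y' z' : C} {f : x ⟶ x'} {g : y ⟶ y'} {h : z ⟶ z'}
    {p : x ⟶ y} {q : y ⟶ z} {p' : x' ⟶ y'} {q' : y' ⟶ z'}
    (n₁ : p ≫ g ⟶ f ≫ p') (n₂ : q ≫ h ⟶ g ≫ q') (h₁ : p ≫ g = f ≫ p') (h₂ : q ≫ h = g ≫ q')
    (e₁ : n₁ = eqToHom h₁) (e₂ : n₂ = eqToHom h₂) :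
    ∃ e : (p ≫ q) ≫ h = f ≫ p' ≫ q',
      (α_ p q h).hom ≫ p ◁ n₂ ≫ (α_ p g q').inv ≫ n₁ ▷ q' ≫ (α_ f p' q').hom = eqToHom e := by
  refine ⟨by rw [Strict.assoc, h₂, ← Strict.assoc, h₁, Strict.assoc], ?_⟩
  subst e₁ e₂
  simp [Strict.associator_eqToIso]

end

/-- The pseudonatural transformations among the lax ones. -/
def pseudonatural : OneCellProperty (LaxCopresheaf.{w, v, u, t} A) where
  holds φ := ∀ ⦃a b : A⦄ (f : a ⟶ b), IsIso (φ.hom.naturality f)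
  id_mem F a b f := by
    change IsIso ((λ_ (F.map f)).hom ≫ (ρ_ (F.map f)).inv)
    infer_instance
  comp_mem {F G H} φ ψ hφ hψ a b f := pseudo_comp _ _ (hφ f) (hψ f)

/-- The (strict) 2-natural transformations among the lax ones. -/
def twoNatural : OneCellProperty (LaxCopresheaf.{w, v, u, t} A) where
  holds {F G} φ := ∀ ⦃a b : A⦄ (f : a ⟶ b),
    ∃ h : φ.hom.app a ≫ G.map f = F.map f ≫ φ.hom.app b, φ.hom.naturality f = eqToHom h
  id_mem F a b f := ⟨(Strict.id_comp (F.map f)).trans (Strict.comp_id (F.map f)).symm,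
    id_naturality (F.map f)⟩
  comp_mem φ ψ hφ hψ a b f := by
    obtain ⟨h, h'⟩ := hφ f
    obtain ⟨k, k'⟩ := hψ f
    exact strict_comp _ _ h k h' k'

/-- The 1-cells of `Fib(A)` whose underlying functor is cartesian, i.e. preserves cocartesian
morphisms. -/
def cartesian : OneCellProperty (Fib.{w, v, u, t} A) where
  holds {P Q} H := ∀ ⦃x y : P.toOver.carrier⦄ (φ : x ⟶ y),
    P.toOver.proj.toFunctor.IsStronglyCocartesian (P.toOver.proj.map φ) φ →
      Q.toOver.proj.toFunctor.IsStronglyCocartesian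
        (Q.toOver.proj.map (H.hom.functor.map φ)) (H.hom.functor.map φ)
  id_mem _ _ _ _ h := h
  comp_mem _ _ h h' _ _ φ hφ := h' _ (h φ hφ)

/-- The 1-cells of `Fib(A)` whose underlying functor preserves the cleavages. -/
def cleavagePreserving : OneCellProperty (Fib.{w, v, u, t} A) where
  holds {P Q} H := ∀ ⦃x y : P.toOver.carrier⦄ (φ : x ⟶ y),
    P.splitting.chosen φ → Q.splitting.chosen (H.hom.functor.map φ)
  id_mem _ _ _ _ h := h
  comp_mem _ _ h h' _ _ φ hφ := h' _ (h φ hφ)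

end Main

end TwoElements

/-! In `∫F` every 1-cell factors as $(f,a) = (\mathrm{id},a)\circ(f,\mathrm{id})$: a chosen lift
followed by a vertical 1-cell. A 2-functor $\int F\to\int G$ over $\mathcal A$ is therefore
determined by its values on vertical 1-cells, which form functors $\varphi_B\colon F(B)\to G(B)$,
and on the chosen lifts, whose fibre parts are the components $(\varphi_f)_X\colon G(f)(\varphi_B
X)\to\varphi_C(F(f)X)$. Functoriality and compatibility with 2-cells translate into the axioms of a
lax transformation (`SliceMap.toLax`, `SliceMap.ofLax_toLax`, `SliceMap.toLax_ofLax`). Likewise a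
vertical 2-natural transformation has components `vert θ`, and its naturality on vertical 1-cells
and on chosen lifts says that `θ` is a modification (`exists_mapTrans_eq`). So `∫` is an isomorphism
on hom-categories.

The 1-cell $(f,a)$ is opcartesian iff $a$ is invertible, and chosen iff $a$ is an identity. As
$\varphi$ sends $(f,\mathrm{id})$ to $(f,\varphi_f)$, preserving opcartesian 1-cells means that all
$\varphi_f$ are invertible, and preserving chosen ones that they are identities.

For essential surjectivity, a split discrete 2-opfibration $P$ yields a 2-functor of fibres. The
splitting makes reindexing strictly functorial on 1-cells. For $\delta\colon f\Rightarrow g$, the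
discrete fibration on homs lifts $\delta$ to a 2-cell ending at the chosen lift of $g$; its source
lies over $f$, so it factors through the chosen lift of $f$ by a vertical 1-cell, which is
$F(\delta)_X$. Uniqueness of lifts gives all the equations (`FibreModel.fibres`). The comparison of
the resulting category of elements with $P$ is bijective on objects, 1-cells and 2-cells and
preserves and reflects chosen lifts, so it is an isomorphism in all three 2-categories
(`exists_iso_elements`). -/

namespace TwoElements

/-! ### 2-functors over `A` between 2-categories of elements are lax transformations -/

namespace Elements

variable {A : Type u} [Bicategory.{w, v} A] {F G : StrictPseudofunctor A Cat.{t, t}}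

variable (F G) in
/-- The data of a 2-functor `∫F ⥤ ∫G` that commutes with the projections, in a form where it
commutes with them by definition. -/
structure SliceMap where
  obj (X : Elements F) : G.obj X.base
  fib {X Y : Elements F} (f : X ⟶ Y) : (G.map f.base).toFunctor.obj (obj X) ⟶ obj Y
  fib_comm {X Y : Elements F} {f g : X ⟶ Y} (δ : f ⟶ g) :
    fib f = (G.map₂ δ.base).toNatTrans.app (obj X) ≫ fib g
  fib_id (X : Elements F) : fib (𝟙 X) = (G.mapId X.base).hom.toNatTrans.app (obj X)
  fib_comp {X Y Z : Elements F} (f : X ⟶ Y) (g : Y ⟶ Z) : fib (f ≫ g) =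
    (G.mapComp f.base g.base).hom.toNatTrans.app (obj X) ≫
      (G.map g.base).toFunctor.map (fib f) ≫ fib g

namespace SliceMap

theorem ext' {D E : SliceMap F G} (h : ∀ X, D.obj X = E.obj X)
    (h' : ∀ {X Y : Elements F} (f : X ⟶ Y), HEq (D.fib f) (E.fib f)) : D = E := by
  obtain ⟨o, m, _, _, _⟩ := D
  obtain ⟨o', m', _, _, _⟩ := E
  obtain rfl : o = o' := funext h
  have : @m = @m' := by
    funext X Y f
    exact eq_of_heq (h' f)
  subst this
  rfl

variable (D : SliceMap F G)

section

variable [Strict A]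

/-- The 2-functor `∫F ⥤ ∫G` over `A` given by the data of a `SliceMap`. -/
def toTwoFunctor : StrictPseudofunctor (Elements F) (Elements G) :=
  StrictPseudofunctor.mk'' {
    obj X := ⟨X.base, D.obj X⟩
    map {X Y} f := (Hom.mk f.base (D.fib f) : (⟨X.base, D.obj X⟩ : Elements G) ⟶ ⟨Y.base, D.obj Y⟩)
    map₂ δ := Hom₂.mk δ.base (D.fib_comm δ)
    map₂_id _ := rfl
    map₂_comp _ _ := rfl
    map_id X := Hom.ext rfl (heq_of_eq (D.fib_id X))
    map_comp f g := Hom.ext rfl (heq_of_eq (D.fib_comp f g))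
    map₂_whisker_left _ _ _ _ := eq_conj _ _ _ _ HEq.rfl
    map₂_whisker_right _ _ := eq_conj _ _ _ _ HEq.rfl }

theorem toTwoFunctor_injective :
    Function.Injective fun D : SliceMap F G => D.toTwoFunctor := by
  intro D E h
  obtain ⟨o, m, c, i, k⟩ := D
  obtain ⟨o', m', c', i', k'⟩ := E
  have h₀ : o = o' := by
    funext X
    have := congrArg (fun K : StrictPseudofunctor (Elements F) (Elements G) => K.obj X) h
    injection this
  subst h₀
  -- The type of the action on 1-cells depends on the action on objects, so equal 2-functors give
  -- heterogeneous equalities; these become honest ones here because the object parts have already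
  -- been identified.
  have key : ∀ (K L : StrictPseudofunctor (Elements F) (Elements G)), K = L →
      ∀ {X Y : Elements F} (f : X ⟶ Y), HEq (K.map f) (L.map f) := by
    rintro K _ rfl X Y f
    rfl
  refine ext' (fun _ => rfl) fun {X Y} f => ?_
  have := eq_of_heq (key _ _ h f)
  injection this with _ h
  exact heq_of_eq h

/-- The base components of a 2-functor over `A` agree with those of its argument only
propositionally. Unbundling the 2-functor into plain functions turns these components into variables
that can be substituted away; what is left is the fibre part, and the 2-cells reduce to the
condition `fib_comm`. -/
theorem exists_of_data (o : Elements F → Elements G) (m : ∀ X Y : Elements F, (X ⟶ Y) → (o X ⟶ o Y))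
    (m₂ : ∀ (X Y : Elements F) (f g : X ⟶ Y), (f ⟶ g) → (m X Y f ⟶ m X Y g))
    (m_id : ∀ X, m X X (𝟙 X) = 𝟙 (o X))
    (m_comp : ∀ X Y Z (f : X ⟶ Y) (g : Y ⟶ Z), m X Z (f ≫ g) = m X Y f ≫ m Y Z g)
    (h₀ : ∀ X, (o X).base = X.base)
    (h₁ : ∀ X Y (f : X ⟶ Y), HEq (m X Y f).base f.base)
    (h₂ : ∀ X Y (f g : X ⟶ Y) (δ : f ⟶ g), HEq (m₂ X Y f g δ).base δ.base) :
    ∃ D : SliceMap F G, (∀ X, o X = D.toTwoFunctor.obj X) ∧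
      (∀ X Y (f : X ⟶ Y), HEq (m X Y f) (D.toTwoFunctor.map f)) ∧
      ∀ X Y (f g : X ⟶ Y) (δ : f ⟶ g), HEq (m₂ X Y f g δ) (D.toTwoFunctor.map₂ δ) := by
  -- By eta for structures, the base part becomes a free variable `b`, ready to be replaced by `fun
  -- X => X.base`.
  obtain ⟨b, y, rfl⟩ : ∃ (b : Elements F → A) (y : ∀ X, G.obj (b X)), o = fun X => ⟨b X, y X⟩ :=
    ⟨_, _, rfl⟩
  obtain rfl : b = fun X => X.base := funext h₀
  obtain ⟨mb, mf, rfl⟩ : ∃ (mb : ∀ X Y : Elements F, (X ⟶ Y) → (X.base ⟶ Y.base))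
      (mf : ∀ X Y f, (G.map (mb X Y f)).toFunctor.obj (y X) ⟶ y Y),
      m = fun X Y f =>
        (Hom.mk (mb X Y f) (mf X Y f) : (⟨X.base, y X⟩ : Elements G) ⟶ ⟨Y.base, y Y⟩) :=
    ⟨_, _, rfl⟩
  obtain rfl : mb = fun X Y f => f.base := by
    funext X Y f
    exact eq_of_heq (h₁ X Y f)
  have h₂' : ∀ X Y (f g : X ⟶ Y) (δ : f ⟶ g), (m₂ X Y f g δ).base = δ.base :=
    fun X Y f g δ => eq_of_heq (h₂ X Y f g δ)
  refine ⟨⟨y, fun {X Y} f => mf X Y f, fun {X Y f g} δ => ?_, fun X => ?_, fun {X Y Z} f g => ?_⟩,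
    fun _ => rfl, fun _ _ _ => HEq.rfl, fun X Y f g δ => heq_of_eq (hom₂_ext (h₂' X Y f g δ))⟩
  · rw [← h₂' X Y f g δ]
    exact (m₂ X Y f g δ).comm
  · have := m_id X
    injection this
  · have := m_comp X Y Z f g
    injection this

theorem exists_eq_toTwoFunctor (H : StrictPseudofunctor (Elements F) (Elements G))
    (h : H.comp (proj G) = proj F) : ∃ D : SliceMap F G, D.toTwoFunctor = H := by
  have key : ∀ (K L : StrictPseudofunctor (Elements F) A), K = L →
      (∀ X, K.obj X = L.obj X) ∧ (∀ {X Y : Elements F} (f : X ⟶ Y), HEq (K.map f) (L.map f)) ∧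
      ∀ {X Y : Elements F} {f g : X ⟶ Y} (δ : f ⟶ g), HEq (K.map₂ δ) (L.map₂ δ) := by
    rintro K _ rfl
    exact ⟨fun _ => rfl, fun _ => HEq.rfl, fun _ => HEq.rfl⟩
  obtain ⟨h₀, h₁, h₂⟩ := key _ _ h
  obtain ⟨D, e₀, e₁, e₂⟩ := exists_of_data H.obj (fun _ _ f => H.map f) (fun _ _ _ _ δ => H.map₂ δ)
    H.map_id (fun _ _ _ => H.map_comp) h₀ (fun _ _ => h₁) (fun _ _ _ _ => h₂)
  exact ⟨D, (twoFunctor_ext_heq e₀ (e₁ _ _) (e₂ _ _ _ _)).symm⟩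

end

/-- The `SliceMap` of the 2-functor induced by a lax transformation. -/
def ofLax (φ : Lax.LaxTrans F.toLax G.toLax) : SliceMap F G where
  obj X := (laxApp φ X.base).obj X.fiber
  fib {X Y} f := laxStr φ f.base X.fiber ≫ (laxApp φ Y.base).map f.fiber
  fib_comm δ := mapHom₂_comm φ δ
  fib_id X := laxStr_id φ X.base X.fiber
  fib_comp f g := mapHom_comp_fiber φ f g

/-- The action of a `SliceMap` on an object of a fibre. -/
def fobj {B : A} (x : F.obj B) : G.obj B := D.obj ⟨B, x⟩

/-- The action of a `SliceMap` on a 1-cell with explicit components. -/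
def fhom {B C : A} (f : B ⟶ C) {x : F.obj B} {y : F.obj C}
    (a : (F.map f).toFunctor.obj x ⟶ y) : (G.map f).toFunctor.obj (D.fobj x) ⟶ D.fobj y :=
  D.fib (X := ⟨B, x⟩) (Y := ⟨C, y⟩) (Hom.mk f a)

/-- Every `δ : f ⟶ g` is a 2-cell of `∫F` into $(g,a)$ from the 1-cell over `f` whose fibre part is
forced by the definition of 2-cells. -/
theorem fhom_map₂ {B C : A} {f g : B ⟶ C} (δ : f ⟶ g) {x : F.obj B} {y : F.obj C}
    (a : (F.map g).toFunctor.obj x ⟶ y) :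
    D.fhom f ((F.map₂ δ).toNatTrans.app x ≫ a) =
      (G.map₂ δ).toNatTrans.app (D.fobj x) ≫ D.fhom g a :=
  D.fib_comm (X := ⟨B, x⟩) (Y := ⟨C, y⟩) (f := Hom.mk f _) (g := Hom.mk g a) (Hom₂.mk δ rfl)

theorem fhom_comp {B C E : A} (f : B ⟶ C) (g : C ⟶ E) {x : F.obj B} {y : F.obj C} {z : F.obj E}
    (a : (F.map f).toFunctor.obj x ⟶ y) (b : (F.map g).toFunctor.obj y ⟶ z) :
    D.fhom (f ≫ g) ((F.mapComp f g).hom.toNatTrans.app x ≫ (F.map g).toFunctor.map a ≫ b) =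
      (G.mapComp f g).hom.toNatTrans.app (D.fobj x) ≫
        (G.map g).toFunctor.map (D.fhom f a) ≫ D.fhom g b :=
  D.fib_comp (X := ⟨B, x⟩) (Y := ⟨C, y⟩) (Z := ⟨E, z⟩) (Hom.mk f a) (Hom.mk g b)

theorem fhom_id {B : A} (x : F.obj B) : D.fhom (𝟙 B) ((F.mapId B).hom.toNatTrans.app x) =
    (G.mapId B).hom.toNatTrans.app (D.fobj x) :=
  D.fib_id ⟨B, x⟩

/-- The action of a `SliceMap` on a morphism of a fibre. -/
def fmap {B : A} {x y : F.obj B} (α : x ⟶ y) : D.fobj x ⟶ D.fobj y :=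
  -- This is the image of `vert α`; the inverse of `G.mapId` removes the functor `G.map (𝟙 B)` from
  -- its source.
  (G.mapId B).inv.toNatTrans.app (D.fobj x) ≫ D.fhom (𝟙 B) ((F.mapId B).hom.toNatTrans.app x ≫ α)

/-- Postcomposing $(f,a)$ with a vertical 1-cell lands over `f ≫ 𝟙 C`. The unitor `ρ_ f`, as a
2-cell of `∫F`, carries the result back over `f`, so strictness of `A` is not needed.
`fhom_comp_left` is the same argument with `λ_ f`. -/
theorem fhom_comp_right {B C : A} {x : F.obj B} {y y' : F.obj C} (f : B ⟶ C)
    (a : (F.map f).toFunctor.obj x ⟶ y) (β : y ⟶ y') :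
    D.fhom f (a ≫ β) = D.fhom f a ≫ D.fmap β := by
  have h := D.fhom_map₂ (ρ_ f).hom (a ≫ β)
  have h₁ := D.fhom_comp f (𝟙 C) a ((F.mapId C).hom.toNatTrans.app y ≫ β)
  have h₂ := (F.mapId C).hom.toNatTrans.naturality a
  have h₃ := (G.mapId C).inv.toNatTrans.naturality (D.fhom f a)
  rw [F.map₂_right_unitor, G.map₂_right_unitor] at h
  dsimp at h h₂ h₃
  rw [reassoc_of% h₂] at h₁
  simp only [Category.id_comp, Category.assoc] at h
  rw [h₁] at h
  simp only [fmap]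
  rw [reassoc_of% h₃]
  have h₄ := congrArg (fun t => (G.mapId C).inv.toNatTrans.app _ ≫
    (G.mapComp f (𝟙 C)).inv.toNatTrans.app (D.fobj x) ≫ t) h
  simpa using h₄.symm

theorem fhom_comp_left {B C : A} {x x' : F.obj B} {y : F.obj C} (α : x ⟶ x') (f : B ⟶ C)
    (b : (F.map f).toFunctor.obj x' ⟶ y) :
    D.fhom f ((F.map f).toFunctor.map α ≫ b) = (G.map f).toFunctor.map (D.fmap α) ≫ D.fhom f b := by
  have h := D.fhom_map₂ (λ_ f).hom ((F.map f).toFunctor.map α ≫ b)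
  have h₁ := D.fhom_comp (𝟙 B) f ((F.mapId B).hom.toNatTrans.app x ≫ α) b
  rw [F.map₂_left_unitor, G.map₂_left_unitor] at h
  dsimp at h
  simp only [Category.id_comp, Category.assoc, Functor.map_comp] at h h₁
  rw [h₁] at h
  have h₄ := congrArg (fun t => (G.map f).toFunctor.map ((G.mapId B).inv.toNatTrans.app _) ≫
    (G.mapComp (𝟙 B) f).inv.toNatTrans.app (D.fobj x) ≫ t) h
  simp only [fmap, Functor.map_comp, Category.assoc]
  simp at h₄
  rw [h₄]
  simp [← Functor.map_comp_assoc]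

/-- The action of a `SliceMap` on the chosen lift of a 1-cell. -/
def str {B C : A} (f : B ⟶ C) (x : F.obj B) :
    (G.map f).toFunctor.obj (D.fobj x) ⟶ D.fobj ((F.map f).toFunctor.obj x) :=
  D.fhom f (𝟙 _)

/-- The factorisation of $(f,a)$ into a chosen lift and a vertical 1-cell: the values `str` and
`fmap` determine everything. -/
theorem fhom_eq {B C : A} {x : F.obj B} {y : F.obj C} (f : B ⟶ C)
    (a : (F.map f).toFunctor.obj x ⟶ y) : D.fhom f a = D.str f x ≫ D.fmap a := by
  rw [str, ← fhom_comp_right, Category.id_comp]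

theorem fmap_id {B : A} (x : F.obj B) : D.fmap (𝟙 x) = 𝟙 _ := by
  have h : D.fmap (𝟙 x) = (G.mapId B).inv.toNatTrans.app (D.fobj x) ≫
      D.fhom (𝟙 B) ((F.mapId B).hom.toNatTrans.app x) :=
    congrArg (fun t => _ ≫ D.fhom (𝟙 B) t) (Category.comp_id _)
  rw [h, fhom_id]
  simp

theorem fmap_comp {B : A} {x y z : F.obj B} (α : x ⟶ y) (β : y ⟶ z) :
    D.fmap (α ≫ β) = D.fmap α ≫ D.fmap β := by
  have h := D.fhom_comp_right (𝟙 B) ((F.mapId B).hom.toNatTrans.app x ≫ α) β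
  exact (congrArg (fun t => _ ≫ t) ((congrArg (D.fhom _) (Category.assoc _ _ _).symm).trans h)).trans
    (Category.assoc _ _ _).symm

/-- Both sides are the value of `D.fhom f` at `(F.map f).toFunctor.map α`, factored on either side.
-/
theorem str_naturality {B C : A} {x y : F.obj B} (f : B ⟶ C) (α : x ⟶ y) :
    (G.map f).toFunctor.map (D.fmap α) ≫ D.str f y =
      D.str f x ≫ D.fmap ((F.map f).toFunctor.map α) := by
  rw [← fhom_eq, str, ← fhom_comp_left, Category.comp_id]

theorem str_map₂ {B C : A} {f g : B ⟶ C} (δ : f ⟶ g) (x : F.obj B) :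
    D.str f x ≫ D.fmap ((F.map₂ δ).toNatTrans.app x) =
      (G.map₂ δ).toNatTrans.app (D.fobj x) ≫ D.str g x := by
  rw [← fhom_eq, str, ← fhom_map₂, Category.comp_id]

theorem str_id (B : A) (x : F.obj B) :
    (G.mapId B).inv.toNatTrans.app (D.fobj x) ≫ D.str (𝟙 B) x =
      D.fmap ((F.mapId B).inv.toNatTrans.app x) :=
  congrArg (fun t => _ ≫ D.fhom (𝟙 B) t)
    (Cat.Hom.hom_inv_id_toNatTrans_app (F.mapId B) x).symm

/-- Taking the inverse of `F.mapComp` as second fibre part makes the composite exactly the chosen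
lift of `f ≫ g`, so `fhom_comp` applies to `str (f ≫ g)`. -/
theorem str_comp {B C E : A} (f : B ⟶ C) (g : C ⟶ E) (x : F.obj B) :
    (G.mapComp f g).inv.toNatTrans.app (D.fobj x) ≫ D.str (f ≫ g) x =
      (G.map g).toFunctor.map (D.str f x) ≫ D.str g ((F.map f).toFunctor.obj x) ≫
        D.fmap ((F.mapComp f g).inv.toNatTrans.app x) := by
  have h := D.fhom_comp f g (𝟙 _) ((F.mapComp f g).inv.toNatTrans.app x)
  have e : (F.mapComp f g).hom.toNatTrans.app x ≫ (F.map g).toFunctor.map (𝟙 _) ≫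
      (F.mapComp f g).inv.toNatTrans.app x = 𝟙 _ := by
    simp
  rw [e] at h
  have h' : D.str (f ≫ g) x = _ := h
  have h₂ := D.fhom_eq g ((F.mapComp f g).inv.toNatTrans.app x)
  rw [h', Cat.Hom.inv_hom_id_toNatTrans_app_assoc]
  exact congrArg (fun t => _ ≫ t) h₂

/-- The component functors of the lax transformation given by a `SliceMap`. -/
@[simps]
def laxFunctor (B : A) : F.obj B ⥤ G.obj B where
  obj := D.fobj
  map := D.fmap
  map_id := D.fmap_id
  map_comp := D.fmap_comp

/-- The structure 2-cells of the lax transformation given by a `SliceMap`. -/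
@[simps]
def laxNatTrans {B C : A} (f : B ⟶ C) :
    D.laxFunctor B ⋙ (G.map f).toFunctor ⟶ (F.map f).toFunctor ⋙ D.laxFunctor C where
  app := D.str f
  naturality _ _ α := D.str_naturality f α

/-- The lax transformation given by a `SliceMap`. -/
def toLax : Lax.LaxTrans F.toLax G.toLax where
  app B := Cat.Hom.ofFunctor (D.laxFunctor B)
  naturality f := Cat.Hom₂.ofNatTrans (D.laxNatTrans f)
  naturality_naturality δ := Cat.Hom₂.ext (NatTrans.ext (funext (D.str_map₂ δ)))
  naturality_id B := Cat.Hom₂.ext (NatTrans.ext (funext fun x => by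
    refine (D.str_id B x).trans ?_
    -- The identities are the components of the unitors of `Cat` in the lax unit axiom; in the
    -- composition axiom below they come from the associators.
    change _ = 𝟙 _ ≫ 𝟙 _ ≫ D.fmap ((F.mapId B).inv.toNatTrans.app x)
    simp))
  naturality_comp f g := Cat.Hom₂.ext (NatTrans.ext (funext fun x => by
    refine (D.str_comp f g x).trans ?_
    change _ = 𝟙 _ ≫ (G.map g).toFunctor.map (D.str f x) ≫ 𝟙 _ ≫
      D.str g ((F.map f).toFunctor.obj x) ≫ 𝟙 _ ≫ D.fmap ((F.mapComp f g).inv.toNatTrans.app x)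
    simp))

theorem ofLax_toLax : ofLax D.toLax = D :=
  ext' (fun _ => rfl) fun f => heq_of_eq (D.fhom_eq f.base f.fiber).symm

theorem fmap_ofLax (φ : Lax.LaxTrans F.toLax G.toLax) {B : A} {x y : F.obj B} (α : x ⟶ y) :
    (ofLax φ).fmap α = (laxApp φ B).map α := by
  change _ ≫ laxStr φ (𝟙 B) x ≫ (laxApp φ B).map ((F.mapId B).hom.toNatTrans.app x ≫ α) = _
  rw [Functor.map_comp, ← Category.assoc (laxStr φ (𝟙 B) x), laxStr_id]
  exact Cat.Hom.inv_hom_id_toNatTrans_app_assoc _ _ _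

theorem str_ofLax (φ : Lax.LaxTrans F.toLax G.toLax) {B C : A} (f : B ⟶ C) (x : F.obj B) :
    (ofLax φ).str f x = laxStr φ f x :=
  (congrArg (fun t => _ ≫ t) ((laxApp φ C).map_id _)).trans (Category.comp_id _)

/-- The component functors agree definitionally on objects, so each `eqToHom` in the comparison of
structure 2-cells has identity components. -/
theorem toLax_ofLax (φ : Lax.LaxTrans F.toLax G.toLax) : (ofLax φ).toLax = φ := by
  refine laxTrans_ext (fun B => Cat.Hom.ext (CategoryTheory.Functor.ext (fun _ => rfl) fun x y α => ?_))
    fun {B C} f => Cat.Hom₂.ext (NatTrans.ext (funext fun x => ?_))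
  · exact (fmap_ofLax φ α).trans ((Category.id_comp _).trans (Category.comp_id _)).symm
  · rw [Cat.Hom₂.comp_app, Cat.Hom₂.comp_app, Cat.eqToHom_app, Cat.eqToHom_app]
    exact (Category.comp_id _).trans ((str_ofLax φ f x).trans (Category.id_comp _).symm)

end SliceMap

section

variable [Strict A]

theorem map_eq_toTwoFunctor (φ : Lax.LaxTrans F.toLax G.toLax) :
    map φ = (SliceMap.ofLax φ).toTwoFunctor :=
  twoFunctor_ext rfl

theorem map_injective :
    Function.Injective fun φ : Lax.LaxTrans F.toLax G.toLax => map φ := by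
  intro φ ψ h
  rw [← SliceMap.toLax_ofLax φ, ← SliceMap.toLax_ofLax ψ]
  exact congrArg SliceMap.toLax (SliceMap.toTwoFunctor_injective h)

theorem exists_map_eq (H : StrictPseudofunctor (Elements F) (Elements G))
    (h : H.comp (proj G) = proj F) : ∃ φ : Lax.LaxTrans F.toLax G.toLax, map φ = H := by
  obtain ⟨D, rfl⟩ := SliceMap.exists_eq_toTwoFunctor H h
  exact ⟨D.toLax, by rw [map_eq_toTwoFunctor, SliceMap.ofLax_toLax]⟩

theorem vert_injective {B : A} {x y : F.obj B} :
    Function.Injective (vert : (x ⟶ y) → ((⟨B, x⟩ : Elements F) ⟶ ⟨B, y⟩)) := by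
  intro α β h
  injection h with _ h
  have h' := congrArg (fun t => (F.mapId B).inv.toNatTrans.app x ≫ t) h
  simpa using h'

/-- With `vert_injective`, this identifies the fibre of `∫F` over `B` with `F.obj B`, `F.mapId`
being invertible. -/
theorem exists_vert {B : A} {x y : F.obj B} (f : (⟨B, x⟩ : Elements F) ⟶ ⟨B, y⟩)
    (h : (proj F).toFunctor.IsHomLift (𝟙 B) f) : ∃ α : x ⟶ y, vert α = f := by
  obtain ⟨f, β⟩ := f
  have hf : 𝟙 B = f := @IsHomLift.eq_of_isHomLift _ _ _ _ (proj F).toFunctor _ _ _ _ h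
  subst hf
  exact ⟨(F.mapId B).inv.toNatTrans.app x ≫ β, Hom.ext rfl (heq_of_eq
    (Cat.Hom.hom_inv_id_toNatTrans_app_assoc (F.mapId B) x β))⟩

theorem mk_injective {B C : A} {x : F.obj B} {y : F.obj C} (f : B ⟶ C)
    {a b : (F.map f).toFunctor.obj x ⟶ y}
    (h : (Hom.mk f a : (⟨B, x⟩ : Elements F) ⟶ ⟨C, y⟩) = Hom.mk f b) : a = b := by
  injection h

/-- A vertical 2-natural transformation between induced 2-functors comes from a modification. -/
theorem exists_mapTrans_eq {φ ψ : F.toLax ⟶ G.toLax} (κ : TwoNatTrans (map φ) (map ψ))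
    (h : ∀ X, (proj G).toFunctor.IsHomLift (𝟙 X.base) (κ.app X)) :
    ∃ Θ : φ ⟶ ψ, mapTrans Θ = κ := by
  -- Verticality of `κ` supplies the components of the modification. Naturality of `κ` at `vert α`
  -- will make each `θ B` natural.
  choose θ hθ using fun (B : A) (x : F.obj B) => exists_vert (κ.app ⟨B, x⟩) (h ⟨B, x⟩)
  have key : ∀ {B C : A} (f : B ⟶ C) {x : F.obj B} {y : F.obj C}
      (a : (F.map f).toFunctor.obj x ⟶ y),
      (laxStr φ f x ≫ (laxApp φ C).map a) ≫ θ C y =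
        (G.map f).toFunctor.map (θ B x) ≫ laxStr ψ f x ≫ (laxApp ψ C).map a := by
    intro B C f x y a
    have hn := κ.naturality (a := ⟨B, x⟩) (b := ⟨C, y⟩) (Hom.mk f a)
    rw [← hθ, ← hθ] at hn
    exact mk_injective f ((mk_comp_vert f _ _).symm.trans (hn.trans (vert_comp_mk _ f _)))
  have nat : ∀ (B : A) {x y : F.obj B} (α : x ⟶ y),
      (laxApp φ B).map α ≫ θ B y = θ B x ≫ (laxApp ψ B).map α := by
    intro B x y α
    have hn := κ.naturality (a := ⟨B, x⟩) (b := ⟨B, y⟩) (vert α)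
    rw [← hθ, ← hθ] at hn
    change mapHom φ (vert α) ≫ _ = _ ≫ mapHom ψ (vert α) at hn
    rw [mapHom_vert, mapHom_vert] at hn
    exact vert_injective ((vert_comp _ _).symm.trans (hn.trans (vert_comp _ _)))
  refine ⟨⟨⟨fun B => Cat.Hom₂.ofNatTrans ⟨θ B, fun x y α => nat B α⟩, fun {B C} f =>
    Cat.Hom₂.ext (NatTrans.ext (funext fun x => ?_))⟩⟩, TwoNatTrans.ext' fun X => hθ X.base X.fiber⟩
  -- Naturality of `κ` at the chosen lift of `f` is the modification axiom.
  have hk := key f (𝟙 ((F.map f).toFunctor.obj x))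
  rw [CategoryTheory.Functor.map_id, CategoryTheory.Functor.map_id, Category.comp_id,
    Category.comp_id] at hk
  exact hk.symm

theorem mapTrans_injective {φ ψ : F.toLax ⟶ G.toLax} :
    Function.Injective (mapTrans : (φ ⟶ ψ) → TwoNatTrans (map φ) (map ψ)) := by
  intro Θ Ξ h
  ext B x
  exact vert_injective (congrArg (fun κ : TwoNatTrans (map φ) (map ψ) => κ.app ⟨B, x⟩) h)

end

end Elements

/-! ### Bijectivity of `∫` on 1-cells and 2-cells -/

section

variable (A : Type u) [Bicategory.{w, v} A] [Strict A]

theorem elements_bijective_map (F G : LaxCopresheaf.{w, v, u, t} A) :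
    Function.Bijective fun φ : F ⟶ G => (elements A).map φ := by
  constructor
  · intro φ ψ h
    refine InducedBicategory.hom_ext (Elements.map_injective ?_)
    exact congrArg (fun H => TwoCatOver.Hom.functor (InducedBicategory.Hom.hom H)) h
  · intro H
    obtain ⟨φ, hφ⟩ := Elements.exists_map_eq H.hom.functor H.hom.comm
    exact ⟨InducedBicategory.mkHom φ, InducedBicategory.hom_ext (TwoCatOver.hom_ext hφ)⟩

theorem elements_bijective_map₂ {F G : LaxCopresheaf.{w, v, u, t} A} (φ ψ : F ⟶ G) :
    Function.Bijective fun Θ : φ ⟶ ψ => (elements A).map₂ Θ := by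
  constructor
  · intro Θ Ξ h
    refine InducedBicategory.hom₂_ext (Elements.mapTrans_injective ?_)
    exact congrArg (fun κ => TwoCatOver.Hom₂.trans (InducedBicategory.Hom₂.hom κ)) h
  · intro κ
    obtain ⟨Θ, hΘ⟩ := Elements.exists_mapTrans_eq (φ := φ.hom) (ψ := ψ.hom)
      (TwoCatOver.Hom₂.trans κ.hom) (TwoCatOver.Hom₂.vertical κ.hom)
    exact ⟨InducedBicategory.Hom₂.mk Θ, InducedBicategory.hom₂_ext (TwoCatOver.hom₂_ext fun X =>
      congrArg (fun κ => TwoNatTrans.app κ X) hΘ)⟩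

end

end TwoElements

namespace TwoElements

/-! ### Opcartesian and chosen 1-cells; pseudonatural and 2-natural transformations -/

namespace Elements

variable {A : Type u} [Bicategory.{w, v} A] [Strict A] {F G : StrictPseudofunctor A Cat.{t, t}}

theorem isIso_vert {B : A} {x y : F.obj B} (α : x ⟶ y) [IsIso α] :
    IsIso (vert α : (⟨B, x⟩ : Elements F) ⟶ ⟨B, y⟩) :=
  ⟨vert (inv α), by rw [vert_comp, IsIso.hom_inv_id, vert_id],
    by rw [vert_comp, IsIso.inv_hom_id, vert_id]⟩

theorem isHomLift_vert {B : A} {x y : F.obj B} (α : x ⟶ y) :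
    (proj F).toFunctor.IsHomLift (𝟙 B) (vert α : (⟨B, x⟩ : Elements F) ⟶ ⟨B, y⟩) :=
  IsHomLift.map (p := (proj F).toFunctor) (vert α : (⟨B, x⟩ : Elements F) ⟶ ⟨B, y⟩)

theorem isHomLift_mk {B C : A} {x : F.obj B} {y : F.obj C} (f : B ⟶ C)
    (a : (F.map f).toFunctor.obj x ⟶ y) :
    (proj F).toFunctor.IsHomLift f (Hom.mk f a : (⟨B, x⟩ : Elements F) ⟶ ⟨C, y⟩) :=
  IsHomLift.map (p := (proj F).toFunctor) (Hom.mk f a : (⟨B, x⟩ : Elements F) ⟶ ⟨C, y⟩)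

theorem isStronglyCocartesian_mk_id {B C : A} (x : F.obj B) (f : B ⟶ C) :
    (proj F).toFunctor.IsStronglyCocartesian f
      (Hom.mk f (𝟙 _) : (⟨B, x⟩ : Elements F) ⟶ ⟨C, (F.map f).toFunctor.obj x⟩) :=
  chosen_cocartesian F (Hom.mk f (𝟙 _) : (⟨B, x⟩ : Elements F) ⟶ ⟨C, (F.map f).toFunctor.obj x⟩)
    ⟨rfl, rfl⟩

/-- Since $(f,a)$ is the opcartesian $(f,\mathrm{id})$ followed by `vert a`, it is opcartesian
exactly when the vertical factor is invertible. -/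
theorem isStronglyCocartesian_mk_iff {B C : A} {x : F.obj B} {y : F.obj C} (f : B ⟶ C)
    (a : (F.map f).toFunctor.obj x ⟶ y) :
    (proj F).toFunctor.IsStronglyCocartesian f
      (Hom.mk f a : (⟨B, x⟩ : Elements F) ⟶ ⟨C, y⟩) ↔ IsIso a := by
  have h₀ := isStronglyCocartesian_mk_id x f
  constructor
  · intro h
    have h₁ := isHomLift_mk f (𝟙 ((F.map f).toFunctor.obj x))
    -- Factoring the chosen lift through $(f,a)$ gives the candidate inverse `β`, with `a ≫ β = 𝟙`;
    -- the other identity follows since $(f,a)$ is epic against vertical 1-cells.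
    obtain ⟨χ, ⟨hχ, hχ'⟩, -⟩ := Functor.IsStronglyCocartesian.universal_property (proj F).toFunctor f
      (Hom.mk f a : (⟨B, x⟩ : Elements F) ⟶ ⟨C, y⟩) (𝟙 C) f (Category.comp_id f).symm
      (Hom.mk f (𝟙 _) : (⟨B, x⟩ : Elements F) ⟶ ⟨C, (F.map f).toFunctor.obj x⟩)
    obtain ⟨β, rfl⟩ := exists_vert χ hχ
    rw [mk_comp_vert] at hχ'
    have e₁ : a ≫ β = 𝟙 _ := mk_injective f hχ'
    refine ⟨β, e₁, vert_injective ?_⟩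
    have h₂ := isHomLift_vert (β ≫ a)
    have h₃ := isHomLift_vert (𝟙 y)
    refine Functor.IsStronglyCocartesian.ext (proj F).toFunctor f
      (Hom.mk f a : (⟨B, x⟩ : Elements F) ⟶ ⟨C, y⟩) (𝟙 C) ?_
    rw [mk_comp_vert, mk_comp_vert, ← Category.assoc, e₁, Category.id_comp, Category.comp_id]
  · intro h
    have h₁ := isIso_vert a
    have h₂ := isHomLift_vert a
    have h₃ : (proj F).toFunctor.IsStronglyCocartesian (f ≫ 𝟙 C)
        ((Hom.mk f (𝟙 _) : (⟨B, x⟩ : Elements F) ⟶ ⟨C, (F.map f).toFunctor.obj x⟩) ≫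
          (vert a : _ ⟶ (⟨C, y⟩ : Elements F))) := inferInstance
    rwa [Category.comp_id, mk_comp_vert, Category.id_comp] at h₃

theorem isStronglyCocartesian_iff {X Y : Elements F} (f : X ⟶ Y) :
    (proj F).toFunctor.IsStronglyCocartesian ((proj F).map f) f ↔ IsIso f.fiber :=
  isStronglyCocartesian_mk_iff f.base f.fiber

end Elements

section

theorem isIso_toNatTrans_iff {C D : Cat.{v, u}} {F G : C ⟶ D} (η : F ⟶ G) :
    IsIso η ↔ ∀ X, IsIso (η.toNatTrans.app X) := by
  constructor
  · intro h X
    exact ⟨(inv η).toNatTrans.app X,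
      congrArg (fun η => η.toNatTrans.app X) (IsIso.hom_inv_id η),
      congrArg (fun η => η.toNatTrans.app X) (IsIso.inv_hom_id η)⟩
  · intro h
    have := NatIso.isIso_of_isIso_app η.toNatTrans
    exact ⟨Cat.Hom₂.ofNatTrans (inv η.toNatTrans), Cat.Hom₂.ext (IsIso.hom_inv_id η.toNatTrans),
      Cat.Hom₂.ext (IsIso.inv_hom_id η.toNatTrans)⟩

/-- Naturality with respect to a transformation whose components are `eqToHom`s already forces the
two functors to agree on morphisms. Thus strict naturality can be tested on objects. -/
theorem eq_eqToHom_iff {C D : Cat.{v, u}} {F G : C ⟶ D} (η : F ⟶ G) :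
    (∃ h : F = G, η = eqToHom h) ↔ ∀ X, ∃ h : F.toFunctor.obj X = G.toFunctor.obj X,
      η.toNatTrans.app X = eqToHom h := by
  constructor
  · rintro ⟨rfl, rfl⟩ X
    exact ⟨rfl, rfl⟩
  · intro h
    choose h h' using h
    have e : F = G := Cat.Hom.ext (CategoryTheory.Functor.ext h fun X Y α => by
      have := η.toNatTrans.naturality α
      rw [h', h'] at this
      rw [← reassoc_of% this]
      simp)
    refine ⟨e, Cat.Hom₂.ext (NatTrans.ext (funext fun X => ?_))⟩
    rw [h', Cat.eqToHom_app]

variable (A : Type u) [Bicategory.{w, v} A] [Strict A] {F G : LaxCopresheaf.{w, v, u, t} A}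

variable {A} in
/-- The 2-functor underlying an object of `LaxCopresheaf A`. -/
abbrev LaxCopresheaf.toTwoFunctor (F : LaxCopresheaf.{w, v, u, t} A) :
    StrictPseudofunctor A Cat.{t, t} := F

theorem pseudonatural_iff_laxStr (φ : F ⟶ G) : (pseudonatural A).holds φ ↔
    ∀ {B C : A} (f : B ⟶ C) (x : F.toTwoFunctor.obj B),
      IsIso (Elements.laxStr φ.hom f x) :=
  ⟨fun h _ _ f => (isIso_toNatTrans_iff _).1 (h f),
    fun h _ _ f => (isIso_toNatTrans_iff _).2 (h f)⟩

theorem twoNatural_iff_laxStr (φ : F ⟶ G) : (twoNatural A).holds φ ↔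
    ∀ {B C : A} (f : B ⟶ C) (x : F.toTwoFunctor.obj B),
      ∃ h, Elements.laxStr φ.hom f x = eqToHom h :=
  ⟨fun h _ _ f => (eq_eqToHom_iff _).1 (h f),
    fun h _ _ f => (eq_eqToHom_iff _).2 (h f)⟩

/-- The image of $(f,a)$ has fibre part $\varphi_C(a)\circ(\varphi_f)_X$. If `a` and all $\varphi_f$
are invertible, so is this; conversely, `a = 𝟙` recovers $(\varphi_f)_X$. -/
theorem pseudonatural_iff_cartesian (φ : F ⟶ G) : (pseudonatural A).holds φ ↔
    (cartesian A).holds ((elements A).map φ) := by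
  rw [pseudonatural_iff_laxStr]
  constructor
  · intro h X Y f hf
    have h₁ : IsIso (Elements.Hom.fiber f) := (Elements.isStronglyCocartesian_iff f).1 hf
    have h₂ := h (Elements.Hom.base f) (Elements.fiber X)
    refine (Elements.isStronglyCocartesian_iff (Elements.mapHom φ.hom f)).2 ?_
    exact @IsIso.comp_isIso _ _ _ _ _ _ _ h₂
      (@CategoryTheory.Functor.map_isIso _ _ _ _ _ _ _ _ h₁)
  · intro h B C f x
    have h₁ := h (x := (⟨B, x⟩ : Elements F.toTwoFunctor))
      (y := (⟨C, (F.toTwoFunctor.map f).toFunctor.obj x⟩ : Elements F.toTwoFunctor))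
      (Elements.Hom.mk f (𝟙 _)) (Elements.isStronglyCocartesian_mk_id (F := F.toTwoFunctor) x f)
    have h₂ : IsIso (Elements.laxStr φ.hom f x ≫ (Elements.laxApp φ.hom C).map (𝟙 _)) :=
      (Elements.isStronglyCocartesian_iff (Elements.mapHom φ.hom
        (Elements.Hom.mk f (𝟙 _) : (⟨B, x⟩ : Elements F.toTwoFunctor) ⟶
          ⟨C, (F.toTwoFunctor.map f).toFunctor.obj x⟩))).1 h₁
    rwa [CategoryTheory.Functor.map_id, Category.comp_id] at h₂

/-- The same argument with isomorphisms replaced by `eqToHom`s, which functors preserve and which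
compose. -/
theorem twoNatural_iff_cleavagePreserving (φ : F ⟶ G) : (twoNatural A).holds φ ↔
    (cleavagePreserving A).holds ((elements A).map φ) := by
  rw [twoNatural_iff_laxStr]
  constructor
  · rintro h X Y f ⟨hf, hf'⟩
    obtain ⟨e, he⟩ := h (Elements.Hom.base f) (Elements.fiber X)
    refine ⟨e.trans (congrArg (Elements.laxApp φ.hom (Elements.base Y)).obj hf), ?_⟩
    change Elements.laxStr φ.hom (Elements.Hom.base f) (Elements.fiber X) ≫
      (Elements.laxApp φ.hom (Elements.base Y)).map (Elements.Hom.fiber f) = _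
    rw [he, hf', eqToHom_map, eqToHom_trans]
    rfl
  · intro h B C f x
    obtain ⟨e, he⟩ := h (x := (⟨B, x⟩ : Elements F.toTwoFunctor))
      (y := (⟨C, (F.toTwoFunctor.map f).toFunctor.obj x⟩ : Elements F.toTwoFunctor))
      (Elements.Hom.mk f (𝟙 _)) ⟨rfl, rfl⟩
    change Elements.laxStr φ.hom f x ≫ (Elements.laxApp φ.hom C).map (𝟙 _) = _ at he
    rw [CategoryTheory.Functor.map_id, Category.comp_id] at he
    exact ⟨e, he⟩

end

end TwoElements

namespace TwoElements

/-! ### Strict inverses of 2-functors that are bijective on all cells -/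

section

variable {B : Type u₁} [Bicategory.{w₁, v₁} B] {C : Type u₂} [Bicategory.{w₂, v₂} C]

/-- This and the following congruences allow computation with cells whose boundaries are equal only
propositionally, as happens for `Φ.obj (o c)` and `c` when `o` inverts `Φ` on objects. -/
theorem comp_heq_comp {a b c a' b' c' : C} {f : a ⟶ b} {g : b ⟶ c} {f' : a' ⟶ b'} {g' : b' ⟶ c'}
    (ha : a = a') (hb : b = b') (hc : c = c') (hf : HEq f f') (hg : HEq g g') :
    HEq (f ≫ g) (f' ≫ g') := by
  subst ha hb hc hf hg
  rfl

theorem comp_heq_comp₂ {a b a' b' : C} {f g h : a ⟶ b} {f' g' h' : a' ⟶ b'}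
    {η : f ⟶ g} {θ : g ⟶ h} {η' : f' ⟶ g'} {θ' : g' ⟶ h'}
    (ha : a = a') (hb : b = b') (hf : HEq f f') (hg : HEq g g') (hh : HEq h h') (hη : HEq η η')
    (hθ : HEq θ θ') : HEq (η ≫ θ) (η' ≫ θ') := by
  subst ha hb hf hg hh hη hθ
  rfl

theorem id_heq_id {a b a' b' : C} {f : a ⟶ b} {f' : a' ⟶ b'} (ha : a = a') (hb : b = b')
    (hf : HEq f f') : HEq (𝟙 f) (𝟙 f') := by
  subst ha hb hf
  rfl

theorem whiskerLeft_heq {a b c a' b' c' : C} {f : a ⟶ b} {g h : b ⟶ c} {f' : a' ⟶ b'}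
    {g' h' : b' ⟶ c'} {η : g ⟶ h} {η' : g' ⟶ h'}
    (ha : a = a') (hb : b = b') (hc : c = c') (hf : HEq f f') (hg : HEq g g') (hh : HEq h h')
    (hη : HEq η η') : HEq (f ◁ η) (f' ◁ η') := by
  subst ha hb hc hf hg hh hη
  rfl

theorem whiskerRight_heq {a b c a' b' c' : C} {f g : a ⟶ b} {h : b ⟶ c} {f' g' : a' ⟶ b'}
    {h' : b' ⟶ c'} {η : f ⟶ g} {η' : f' ⟶ g'}
    (ha : a = a') (hb : b = b') (hc : c = c') (hf : HEq f f') (hg : HEq g g') (hh : HEq h h')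
    (hη : HEq η η') : HEq (η ▷ h) (η' ▷ h') := by
  subst ha hb hc hf hg hh hη
  rfl

theorem conj_eqToHom_heq {D : Type*} [Category D] {a b a' b' : D} (h : a' = a) (h' : b = b')
    (f : a ⟶ b) : HEq (eqToHom h ≫ f ≫ eqToHom h') f := by
  subst h h'
  simp

variable (Φ : StrictPseudofunctor B C)

theorem map₂_conj_eqToHom_heq {a b : B} {f g f' g' : a ⟶ b} (h : f' = f) (h' : g = g')
    (η : f ⟶ g) : HEq (Φ.map₂ (eqToHom h ≫ η ≫ eqToHom h')) (Φ.map₂ η) := by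
  subst h h'
  simp

theorem map₂_whiskerLeft_heq {a b c : B} (f : a ⟶ b) {g h : b ⟶ c} (η : g ⟶ h) :
    HEq (Φ.map₂ (f ◁ η)) (Φ.map f ◁ Φ.map₂ η) := by
  rw [WideSub.map₂_whiskerLeft]
  exact conj_eqToHom_heq _ _ _

theorem map₂_whiskerRight_heq {a b c : B} {f g : a ⟶ b} (η : f ⟶ g) (h : b ⟶ c) :
    HEq (Φ.map₂ (η ▷ h)) (Φ.map₂ η ▷ Φ.map h) := by
  rw [WideSub.map₂_whiskerRight]
  exact conj_eqToHom_heq _ _ _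

variable {Φ}

/-- A strict 2-functor that is bijective on objects, 1-cells and 2-cells has a strict inverse. -/
theorem exists_inverse [Strict B] [Strict C] (h₀ : Function.Bijective Φ.obj)
    (h₁ : ∀ x y : B, Function.Bijective fun f : x ⟶ y => Φ.map f)
    (h₂ : ∀ {x y : B} (f g : x ⟶ y), Function.Bijective fun η : f ⟶ g => Φ.map₂ η) :
    ∃ Ψ : StrictPseudofunctor C B, Φ.comp Ψ = StrictPseudofunctor.id B ∧
      Ψ.comp Φ = StrictPseudofunctor.id C := by
  obtain ⟨o, ho, ho'⟩ := Function.bijective_iff_has_inverse.1 h₀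
  -- Injectivity and surjectivity on cells are restated with `HEq`, so that they apply across the
  -- equalities `Φ.obj (o c) = c`.
  have inj₁ : ∀ {x y x' y' : B} {f : x ⟶ y} {f' : x' ⟶ y'}, x = x' → y = y' →
      HEq (Φ.map f) (Φ.map f') → HEq f f' := by
    rintro x y _ _ f f' rfl rfl h
    exact heq_of_eq ((h₁ x y).1 (eq_of_heq h))
  have inj₂ : ∀ {x y x' y' : B} {f g : x ⟶ y} {f' g' : x' ⟶ y'} {η : f ⟶ g} {η' : f' ⟶ g'},
      x = x' → y = y' → HEq f f' → HEq g g' → HEq (Φ.map₂ η) (Φ.map₂ η') → HEq η η' := by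
    rintro x y _ _ f g f' g' η η' rfl rfl hf hg h
    subst hf hg
    exact heq_of_eq ((h₂ f g).1 (eq_of_heq h))
  have ex₁ : ∀ {x y : B} {c d : C} (hc : Φ.obj x = c) (hd : Φ.obj y = d) (f : c ⟶ d),
      ∃ g : x ⟶ y, HEq (Φ.map g) f := by
    rintro x y _ _ rfl rfl f
    obtain ⟨g, hg⟩ := (h₁ x y).2 f
    exact ⟨g, heq_of_eq hg⟩
  have ex₂ : ∀ {x y : B} {c d : C} (hc : Φ.obj x = c) (hd : Φ.obj y = d) {p q : x ⟶ y}
      {f g : c ⟶ d} (hp : HEq (Φ.map p) f) (hq : HEq (Φ.map q) g) (η : f ⟶ g),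
      ∃ θ : p ⟶ q, HEq (Φ.map₂ θ) η := by
    rintro x y _ _ rfl rfl p q f g hp hq η
    subst hp hq
    obtain ⟨θ, hθ⟩ := (h₂ p q).2 η
    exact ⟨θ, heq_of_eq hθ⟩
  choose m hm using fun {c d : C} (f : c ⟶ d) => ex₁ (ho' c) (ho' d) f
  choose m₂ hm₂ using fun {c d : C} {f g : c ⟶ d} (η : f ⟶ g) =>
    ex₂ (ho' c) (ho' d) (hm f) (hm g) η
  -- Each law for the inverse is checked after applying `Φ`, where `hm` and `hm₂` identify the
  -- chosen preimages with the given cells.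
  have m_id : ∀ c : C, m (𝟙 c) = 𝟙 (o c) := fun c => (h₁ _ _).1 (eq_of_heq (by
    refine (hm _).trans ?_
    dsimp only
    rw [Φ.map_id, ho' c]))
  have m_comp : ∀ {c d e : C} (f : c ⟶ d) (g : d ⟶ e), m (f ≫ g) = m f ≫ m g :=
    fun {c d e} f g => (h₁ _ _).1 (eq_of_heq (by
      refine (hm _).trans ?_
      dsimp only
      rw [Φ.map_comp]
      exact (comp_heq_comp (ho' c) (ho' d) (ho' e) (hm f) (hm g)).symm))
  refine ⟨StrictPseudofunctor.mk'' {
    obj := o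
    map := m
    map₂ := m₂
    map₂_id {c d} f := (h₂ _ _).1 (eq_of_heq (by
      refine (hm₂ _).trans ?_
      dsimp only
      rw [Φ.map₂_id]
      exact id_heq_id (ho' c).symm (ho' d).symm (hm f).symm))
    map₂_comp {c d f g h} η θ := (h₂ _ _).1 (eq_of_heq (by
      refine (hm₂ _).trans ?_
      dsimp only
      rw [Φ.map₂_comp]
      exact (comp_heq_comp₂ (ho' c) (ho' d) (hm f) (hm g) (hm h) (hm₂ η) (hm₂ θ)).symm))
    map_id := m_id
    map_comp := m_comp
    map₂_whisker_left {a b c} f g h η := (h₂ _ _).1 (eq_of_heq ((hm₂ _).trans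
      (((map₂_conj_eqToHom_heq Φ _ _ _).trans ((map₂_whiskerLeft_heq Φ _ _).trans
        (whiskerLeft_heq (ho' a) (ho' b) (ho' c) (hm f) (hm g) (hm h) (hm₂ η)))).symm)))
    map₂_whisker_right {a b c f g} η h := (h₂ _ _).1 (eq_of_heq ((hm₂ _).trans
      (((map₂_conj_eqToHom_heq Φ _ _ _).trans ((map₂_whiskerRight_heq Φ _ _).trans
        (whiskerRight_heq (ho' a) (ho' b) (ho' c) (hm f) (hm g) (hm h) (hm₂ η)))).symm))) },
    Elements.twoFunctor_ext_heq ho (fun f => inj₁ (ho _) (ho _) (hm _))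
      (fun η => inj₂ (ho _) (ho _) (inj₁ (ho _) (ho _) (hm _)) (inj₁ (ho _) (ho _) (hm _))
        (hm₂ _)),
    Elements.twoFunctor_ext_heq ho' (fun f => hm f) (fun η => hm₂ η)⟩

end

end TwoElements

namespace TwoElements

/-! ### Lifting 2-cells, and small models of the fibres -/

section

variable {A : Type u₁} [Bicategory.{w₁, v₁} A] [Strict A] {E : Type u₂} [Bicategory.{w₂, v₂} E]
  [Strict E] (P : StrictPseudofunctor E A)

theorem isHomLift_heq {a b : A} {f : a ⟶ b} {x y : E} {φ : x ⟶ y}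
    (h : P.toFunctor.IsHomLift f φ) : HEq (P.map φ) f := by
  obtain ⟨⟩ := h
  rfl

theorem isHomLift_unique {a b : A} {f g : a ⟶ b} {x y : E} {φ : x ⟶ y}
    (h : P.toFunctor.IsHomLift f φ) (h' : P.toFunctor.IsHomLift g φ) : f = g :=
  eq_of_heq ((isHomLift_heq P h).symm.trans (isHomLift_heq P h'))

/-- `Lift₂ P κ δ` expresses that the 2-cell `κ` lies over the 2-cell `δ`. -/
inductive Lift₂ {x y : E} {φ ψ : x ⟶ y} (κ : φ ⟶ ψ) :
    ∀ {a b : A} {f g : a ⟶ b} (_ : f ⟶ g), Prop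
  | refl : Lift₂ κ (P.map₂ κ)

variable {P}

namespace Lift₂

variable {x y z : E} {φ ψ : x ⟶ y} {κ : φ ⟶ ψ} {a b c : A} {f g : a ⟶ b} {δ : f ⟶ g}

theorem left (h : Lift₂ P κ δ) : P.toFunctor.IsHomLift f φ := by
  obtain ⟨⟩ := h
  exact IsHomLift.map (p := P.toFunctor) φ

theorem right (h : Lift₂ P κ δ) : P.toFunctor.IsHomLift g ψ := by
  obtain ⟨⟩ := h
  exact IsHomLift.map (p := P.toFunctor) ψ

theorem heq (h : Lift₂ P κ δ) : HEq (P.map₂ κ) δ := by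
  obtain ⟨⟩ := h
  rfl

theorem of_heq (hφ : P.toFunctor.IsHomLift f φ) (hψ : P.toFunctor.IsHomLift g ψ)
    (h : HEq (P.map₂ κ) δ) : Lift₂ P κ δ := by
  obtain ⟨⟩ := hφ
  obtain rfl : P.map ψ = g := eq_of_heq (isHomLift_heq P hψ)
  obtain rfl : P.map₂ κ = δ := eq_of_heq h
  exact refl

theorem base_unique {δ' : f ⟶ g} (h : Lift₂ P κ δ) (h' : Lift₂ P κ δ') : δ = δ' :=
  eq_of_heq (h.heq.symm.trans h'.heq)

theorem exists_base (hφ : P.toFunctor.IsHomLift f φ) (hψ : P.toFunctor.IsHomLift g ψ)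
    (κ : φ ⟶ ψ) : ∃ δ : f ⟶ g, Lift₂ P κ δ := by
  obtain ⟨⟩ := hφ
  obtain rfl : P.map ψ = g := eq_of_heq (isHomLift_heq P hψ)
  exact ⟨P.map₂ κ, refl⟩

/-- Used to replace `𝟙 a ◁ δ` and `δ ▷ 𝟙 b` by `δ` in the strict 2-category `A`. -/
theorem congr_base {f' g' : a ⟶ b} {δ' : f' ⟶ g'} (h : Lift₂ P κ δ) (hf : f = f') (hg : g = g')
    (hδ : HEq δ δ') : Lift₂ P κ δ' := by
  subst hf hg hδ
  exact h

theorem id (hφ : P.toFunctor.IsHomLift f φ) : Lift₂ P (𝟙 φ) (𝟙 f) := by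
  obtain ⟨⟩ := hφ
  exact of_heq (IsHomLift.map (p := P.toFunctor) φ) (IsHomLift.map (p := P.toFunctor) φ)
    (heq_of_eq (P.map₂_id φ))

theorem comp {χ : x ⟶ y} {θ : ψ ⟶ χ} {h : a ⟶ b} {γ : g ⟶ h} (h₁ : Lift₂ P κ δ)
    (h₂ : Lift₂ P θ γ) : Lift₂ P (κ ≫ θ) (δ ≫ γ) := by
  refine of_heq h₁.left h₂.right ?_
  rw [P.map₂_comp]
  have := h₁.left
  have := h₂.right
  exact comp_heq_comp₂ (IsHomLift.domain_eq P.toFunctor f φ)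
    (IsHomLift.codomain_eq P.toFunctor f φ) (isHomLift_heq P h₁.left)
    (isHomLift_heq P h₁.right) (isHomLift_heq P h₂.right) h₁.heq h₂.heq

theorem whiskerLeft {χ : z ⟶ x} {h : c ⟶ a} (hχ : P.toFunctor.IsHomLift h χ)
    (h₁ : Lift₂ P κ δ) : Lift₂ P (χ ◁ κ) (h ◁ δ) := by
  have := h₁.left
  have := h₁.right
  refine of_heq (IsHomLift.comp (p := P.toFunctor) h f χ φ)
    (IsHomLift.comp (p := P.toFunctor) h g χ ψ) ((map₂_whiskerLeft_heq P χ κ).trans ?_)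
  exact whiskerLeft_heq (IsHomLift.domain_eq P.toFunctor h χ)
    (IsHomLift.domain_eq P.toFunctor f φ) (IsHomLift.codomain_eq P.toFunctor f φ)
    (isHomLift_heq P hχ) (isHomLift_heq P h₁.left) (isHomLift_heq P h₁.right) h₁.heq

theorem whiskerRight {χ : y ⟶ z} {h : b ⟶ c} (h₁ : Lift₂ P κ δ)
    (hχ : P.toFunctor.IsHomLift h χ) : Lift₂ P (κ ▷ χ) (δ ▷ h) := by
  have := h₁.left
  have := h₁.right
  refine of_heq (IsHomLift.comp (p := P.toFunctor) f h φ χ)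
    (IsHomLift.comp (p := P.toFunctor) g h ψ χ) ((map₂_whiskerRight_heq P κ χ).trans ?_)
  exact whiskerRight_heq (IsHomLift.domain_eq P.toFunctor f φ)
    (IsHomLift.codomain_eq P.toFunctor f φ) (IsHomLift.codomain_eq P.toFunctor h χ)
    (isHomLift_heq P h₁.left) (isHomLift_heq P h₁.right) (isHomLift_heq P hχ) h₁.heq

theorem conj {φ' ψ' : x ⟶ y} (h : Lift₂ P κ δ) (hφ : φ' = φ) (hψ : ψ = ψ') :
    Lift₂ P (eqToHom hφ ≫ κ ≫ eqToHom hψ) δ := by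
  subst hφ hψ
  simpa using h

end Lift₂

theorem exists_lift₂ (hP : ∀ x y, IsDiscreteFibration (P.mapFunctor x y))
    {a b : A} {f g : a ⟶ b} {x y : E} {ψ : x ⟶ y}
    (hψ : P.toFunctor.IsHomLift g ψ) (δ : f ⟶ g) :
    ∃ (φ : x ⟶ y) (κ : φ ⟶ ψ), Lift₂ P κ δ := by
  obtain ⟨⟩ := hψ
  obtain ⟨⟨φ, κ⟩, h, -⟩ := hP x y ψ δ
  obtain ⟨h₁, h₂⟩ := (isHomLift_iff_codomain _ _ _).1 h
  change f = P.map φ at h₁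
  subst h₁
  obtain rfl : δ = P.map₂ κ := h₂.trans (Category.id_comp _)
  exact ⟨φ, κ, Lift₂.refl⟩

theorem lift₂_unique (hP : ∀ x y, IsDiscreteFibration (P.mapFunctor x y))
    {a b : A} {f g : a ⟶ b} {x y : E} {φ φ' ψ : x ⟶ y} {κ : φ ⟶ ψ}
    {κ' : φ' ⟶ ψ} {δ : f ⟶ g} (h : Lift₂ P κ δ) (h' : Lift₂ P κ' δ) : φ = φ' ∧ HEq κ κ' := by
  obtain ⟨⟩ := h
  have h₁ : (P.mapFunctor x y).IsHomLift (P.map₂ κ) κ := IsHomLift.map (p := P.mapFunctor x y) κ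
  have h₂ : (P.mapFunctor x y).IsHomLift (P.map₂ κ) κ' :=
    (isHomLift_iff_codomain _ _ _).2 ⟨(eq_of_heq (isHomLift_heq P h'.left)).symm,
      eq_of_heq (h'.heq.symm.trans (eqToHom_comp_heq _ _).symm)⟩
  have e := (hP x y ψ (P.map₂ κ)).unique (y₁ := ⟨φ, κ⟩) (y₂ := ⟨φ', κ'⟩) h₁ h₂
  exact Sigma.mk.inj_iff.1 e

variable (P) in
/-- There is a 2-cell `φ ⟶ ψ` over `δ`. -/
def Cell {a b : A} {f g : a ⟶ b} (δ : f ⟶ g) {x y : E} (φ ψ : x ⟶ y) : Prop :=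
  ∃ κ : φ ⟶ ψ, Lift₂ P κ δ

namespace Cell

variable {x y z : E} {φ ψ : x ⟶ y} {a b c : A} {f g : a ⟶ b} {δ : f ⟶ g}

theorem comp {χ : x ⟶ y} {h : a ⟶ b} {γ : g ⟶ h} (h₁ : Cell P δ φ ψ) (h₂ : Cell P γ ψ χ) :
    Cell P (δ ≫ γ) φ χ :=
  ⟨_, h₁.choose_spec.comp h₂.choose_spec⟩

theorem whiskerLeft {χ : z ⟶ x} {h : c ⟶ a} (hχ : P.toFunctor.IsHomLift h χ)
    (h₁ : Cell P δ φ ψ) : Cell P (h ◁ δ) (χ ≫ φ) (χ ≫ ψ) :=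
  ⟨_, h₁.choose_spec.whiskerLeft hχ⟩

theorem whiskerRight {χ : y ⟶ z} {h : b ⟶ c} (h₁ : Cell P δ φ ψ)
    (hχ : P.toFunctor.IsHomLift h χ) : Cell P (δ ▷ h) (φ ≫ χ) (ψ ≫ χ) :=
  ⟨_, h₁.choose_spec.whiskerRight hχ⟩

/-- Whiskering with a vertical 1-cell does not change the 2-cell below. -/
theorem id_whiskerLeft {χ : z ⟶ x} (hχ : P.toFunctor.IsHomLift (𝟙 a) χ)
    (h₁ : Cell P δ φ ψ) : Cell P δ (χ ≫ φ) (χ ≫ ψ) :=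
  ⟨_, (h₁.choose_spec.whiskerLeft hχ).congr_base (Strict.id_comp f) (Strict.id_comp g)
    (Elements.id_whiskerLeft_heq δ)⟩

theorem whiskerRight_id {χ : y ⟶ z} (h₁ : Cell P δ φ ψ)
    (hχ : P.toFunctor.IsHomLift (𝟙 b) χ) : Cell P δ (φ ≫ χ) (ψ ≫ χ) :=
  ⟨_, (h₁.choose_spec.whiskerRight hχ).congr_base (Strict.comp_id f) (Strict.comp_id g)
    (Elements.whiskerRight_id_heq δ)⟩

/-- The main tool for equations of 1-cells: in a discrete fibration, the target of a lift and the
2-cell below determine its source. -/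
theorem unique (hP : ∀ x y, IsDiscreteFibration (P.mapFunctor x y)) {φ' : x ⟶ y}
    (h : Cell P δ φ ψ) (h' : Cell P δ φ' ψ) : φ = φ' :=
  (lift₂_unique hP h.choose_spec h'.choose_spec).1

end Cell

theorem isStronglyCocartesian_of_isHomLift {a b : A} {f : a ⟶ b} {x y : E} {φ : x ⟶ y}
    (h : P.toFunctor.IsHomLift f φ)
    (h' : P.toFunctor.IsStronglyCocartesian (P.toFunctor.map φ) φ) :
    P.toFunctor.IsStronglyCocartesian f φ := by
  obtain ⟨⟩ := h
  exact h'

variable (P) in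
/-- A model for the fibres of a split discrete 2-opfibration `P` by categories in a fixed
universe, with the chosen lifts expressed in terms of the model. -/
structure FibreModel (S : Splitting P.toFunctor) where
  locallyDiscrete (x y : E) : IsDiscreteFibration (P.mapFunctor x y)
  cat : A → Cat.{t, t}
  inc (a : A) : cat a ⥤ E
  isHomLift {a : A} {X Y : cat a} (α : X ⟶ Y) : P.toFunctor.IsHomLift (𝟙 a) ((inc a).map α)
  obj_injective (a : A) : Function.Injective (inc a).obj
  exists_obj {a : A} {x : E} (h : P.obj x = a) : ∃ X, (inc a).obj X = x
  map_injective {a : A} {X Y : cat a} : Function.Injective ((inc a).map : (X ⟶ Y) → _)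
  exists_map {a : A} {X Y : cat a} (φ : (inc a).obj X ⟶ (inc a).obj Y)
    (h : P.toFunctor.IsHomLift (𝟙 a) φ) : ∃ α : X ⟶ Y, (inc a).map α = φ
  push {a b : A} (f : a ⟶ b) (X : cat a) : cat b
  lift {a b : A} (f : a ⟶ b) (X : cat a) : (inc a).obj X ⟶ (inc b).obj (push f X)
  lift_isHomLift {a b : A} (f : a ⟶ b) (X : cat a) : P.toFunctor.IsHomLift f (lift f X)
  lift_chosen {a b : A} (f : a ⟶ b) (X : cat a) : S.chosen (lift f X)

end

end TwoElements

namespace TwoElements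

/-! ### The strict 2-functor of fibres -/

section

variable {A : Type u₁} [Bicategory.{w₁, v₁} A] [Strict A] {E : Type u₂} [Bicategory.{w₂, v₂} E]
  [Strict E] {P : StrictPseudofunctor E A} {S : Splitting P.toFunctor}

/-- Bijectivity on objects, rather than essential surjectivity, is what later makes the comparison
an isomorphism. Homs are shrunk by `ShrinkHoms`, and the full subcategory structure is then pulled
back along the bijection from `Shrink C`. -/
theorem exists_smallModel (C : Type u) [Category.{v} C] [Small.{t} C] [LocallySmall.{t} C] :
    ∃ (D : Cat.{t, t}) (J : D ⥤ C), Function.Bijective J.obj ∧ J.Full ∧ J.Faithful := by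
  let e : Shrink.{t} C → ShrinkHoms.{u} C := fun X => ShrinkHoms.toShrinkHoms ((equivShrink C).symm X)
  let J : InducedCategory (ShrinkHoms.{u} C) e ⥤ C := inducedFunctor e ⋙ ShrinkHoms.inverse.{t} C
  have h₁ : J.Full := inferInstance
  have h₂ : J.Faithful := inferInstance
  exact ⟨Cat.of (InducedCategory (ShrinkHoms.{u} C) e), J, (equivShrink C).symm.bijective, h₁, h₂⟩

theorem exists_chosen_lift (S : Splitting P.toFunctor) {a b : A} (f : a ⟶ b) {x : E}
    (h : P.obj x = a) :
    ∃ (y : E) (φ : x ⟶ y), P.toFunctor.IsHomLift f φ ∧ S.chosen φ := by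
  subst h
  obtain ⟨⟨y, φ⟩, h, -⟩ := S.existsUnique_lift x f
  exact ⟨y, φ, h⟩

theorem chosen_lift_unique (S : Splitting P.toFunctor) {a b : A} {f : a ⟶ b} {x y y' : E}
    {φ : x ⟶ y} {φ' : x ⟶ y'} (h : P.toFunctor.IsHomLift f φ)
    (h' : P.toFunctor.IsHomLift f φ') (hφ : S.chosen φ) (hφ' : S.chosen φ') :
    ∃ e : y = y', φ ≫ eqToHom e = φ' := by
  have hu := fun {b : A} => S.existsUnique_lift x (b := b)
  obtain ⟨⟩ := h
  have e := (hu (P.map φ)).unique (y₁ := ⟨y, φ⟩) (y₂ := ⟨y', φ'⟩)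
    ⟨IsHomLift.map (p := P.toFunctor) φ, hφ⟩ ⟨h', hφ'⟩
  obtain ⟨rfl, e⟩ := Sigma.mk.inj_iff.1 e
  exact ⟨rfl, (Strict.comp_id φ).trans (eq_of_heq e)⟩

theorem nonempty_fibreModel (S : Splitting P.toFunctor)
    (hP : ∀ x y, IsDiscreteFibration (P.mapFunctor x y))
    (h₁ : ∀ a, Small.{t} (P.toFunctor.Fiber a))
    (h₂ : ∀ a, LocallySmall.{t} (P.toFunctor.Fiber a)) :
    Nonempty (FibreModel.{w₁, w₂, v₁, v₂, u₁, u₂, t} P S) := by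
  choose D J hJ hJ' hJ'' using fun a => exists_smallModel.{v₂, u₂, t} (P.toFunctor.Fiber a)
  have ex : ∀ {a b : A} (f : a ⟶ b) (X : D a), ∃ (Y : D b) (φ : ((J a).obj X).1 ⟶ ((J b).obj Y).1),
      P.toFunctor.IsHomLift f φ ∧ S.chosen φ := by
    intro a b f X
    obtain ⟨y, φ, h, hφ⟩ := exists_chosen_lift S f ((J a).obj X).2
    obtain ⟨Y, hY⟩ := (hJ b).2 ⟨y, IsHomLift.codomain_eq P.toFunctor f φ⟩
    -- Surjectivity on objects lets the codomain of the chosen lift be the image of a model object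
    -- on the nose.
    obtain rfl : ((J b).obj Y).1 = y := congrArg Subtype.val hY
    exact ⟨Y, φ, h, hφ⟩
  choose push lift h using @ex
  exact ⟨{
    locallyDiscrete := hP
    cat := D
    inc a := J a ⋙ Functor.Fiber.fiberInclusion
    isHomLift α := ((J _).map α).2
    obj_injective a := Subtype.val_injective.comp (hJ a).1
    exists_obj {a x} h := by
      obtain ⟨X, hX⟩ := (hJ a).2 ⟨x, h⟩
      exact ⟨X, congrArg Subtype.val hX⟩
    map_injective {a X Y} := by
      have := hJ'' a
      exact Subtype.val_injective.comp (J a).map_injective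
    exists_map {a X Y} φ h := by
      have := hJ' a
      obtain ⟨α, hα⟩ := (J a).map_surjective (X := X) (Y := Y) ⟨φ, h⟩
      exact ⟨α, congrArg Subtype.val hα⟩
    push := push
    lift := lift
    lift_isHomLift f X := (h f X).1
    lift_chosen f X := (h f X).2 }⟩

namespace FibreModel

attribute [instance] FibreModel.isHomLift FibreModel.lift_isHomLift

variable (D : FibreModel.{w₁, w₂, v₁, v₂, u₁, u₂, t} P S)

instance {a b : A} (f : a ⟶ b) (X : D.cat a) :
    P.toFunctor.IsStronglyCocartesian f (D.lift f X) :=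
  isStronglyCocartesian_of_isHomLift (D.lift_isHomLift f X)
    (S.cocartesian _ (D.lift_chosen f X))

variable {D}

theorem obj_inc {a : A} (X : D.cat a) : P.obj ((D.inc a).obj X) = a :=
  IsHomLift.domain_eq P.toFunctor (𝟙 a) ((D.inc a).map (𝟙 X))

/-- Uniqueness in the universal property of the opcartesian chosen lift, together with faithfulness
of `D.inc`. Equations between fibre morphisms out of `D.push f X` are all tested this way. -/
theorem hom_ext {a b : A} {f : a ⟶ b} {X : D.cat a} {Z : D.cat b} {α β : D.push f X ⟶ Z}
    (h : D.lift f X ≫ (D.inc b).map α = D.lift f X ≫ (D.inc b).map β) : α = β :=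
  D.map_injective (Functor.IsStronglyCocartesian.ext P.toFunctor f (D.lift f X) (𝟙 b) h)

variable (D) in
theorem exists_factor {a b : A} (f : a ⟶ b) {X : D.cat a} {Z : D.cat b}
    (ψ : (D.inc a).obj X ⟶ (D.inc b).obj Z) (h : P.toFunctor.IsHomLift f ψ) :
    ∃ α : D.push f X ⟶ Z, D.lift f X ≫ (D.inc b).map α = ψ := by
  obtain ⟨χ, ⟨h₁, h₂⟩, -⟩ := Functor.IsStronglyCocartesian.universal_property P.toFunctor f
    (D.lift f X) (𝟙 b) f (Category.comp_id f).symm ψ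
  obtain ⟨α, rfl⟩ := D.exists_map χ h₁
  exact ⟨α, h₂⟩

theorem eq_lift {a b : A} {f : a ⟶ b} {X : D.cat a} {Y : D.cat b}
    {φ : (D.inc a).obj X ⟶ (D.inc b).obj Y} (h : P.toFunctor.IsHomLift f φ) (h' : S.chosen φ) :
    ∃ e : D.push f X = Y, D.lift f X ≫ (D.inc b).map (eqToHom e) = φ := by
  obtain ⟨e, he⟩ := chosen_lift_unique S (D.lift_isHomLift f X) h (D.lift_chosen f X) h'
  exact ⟨D.obj_injective _ e, by rw [eqToHom_map, he]⟩

theorem lift_id {a : A} (X : D.cat a) : ∃ e : D.push (𝟙 a) X = X,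
    D.lift (𝟙 a) X ≫ (D.inc a).map (eqToHom e) = 𝟙 _ :=
  eq_lift (IsHomLift.id (obj_inc X)) (S.id_mem _)

/-- A composite of chosen lifts is chosen, hence is the chosen lift of the composite up to an
equality of codomains. This is what makes reindexing strictly functorial. -/
theorem lift_comp {a b c : A} (f : a ⟶ b) (g : b ⟶ c) (X : D.cat a) :
    ∃ e : D.push (f ≫ g) X = D.push g (D.push f X),
      D.lift (f ≫ g) X ≫ (D.inc c).map (eqToHom e) = D.lift f X ≫ D.lift g (D.push f X) :=
  eq_lift inferInstance (S.comp_mem _ _ (D.lift_chosen f X) (D.lift_chosen g _))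

/-- The action on morphisms of the reindexing functor along a 1-cell. -/
noncomputable def pushMap {a b : A} (f : a ⟶ b) {X Y : D.cat a} (α : X ⟶ Y) :
    D.push f X ⟶ D.push f Y :=
  (D.exists_factor f ((D.inc a).map α ≫ D.lift f Y) inferInstance).choose

@[simp]
theorem lift_pushMap {a b : A} (f : a ⟶ b) {X Y : D.cat a} (α : X ⟶ Y) :
    D.lift f X ≫ (D.inc b).map (pushMap f α) = (D.inc a).map α ≫ D.lift f Y :=
  (D.exists_factor f ((D.inc a).map α ≫ D.lift f Y) inferInstance).choose_spec

@[simp]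
theorem lift_pushMap_assoc {a b : A} (f : a ⟶ b) {X Y : D.cat a} (α : X ⟶ Y) {z : E}
    (ψ : (D.inc b).obj (D.push f Y) ⟶ z) :
    D.lift f X ≫ (D.inc b).map (pushMap f α) ≫ ψ = (D.inc a).map α ≫ D.lift f Y ≫ ψ := by
  rw [← Category.assoc, lift_pushMap, Category.assoc]

/-- The reindexing functor along a 1-cell. -/
noncomputable def pushFunctor {a b : A} (f : a ⟶ b) : D.cat a ⥤ D.cat b where
  obj := D.push f
  map := pushMap f
  map_id X := hom_ext (by simp)
  map_comp α β := hom_ext (by simp)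

theorem lift_id' {a : A} (X : D.cat a) : ∃ e : X = D.push (𝟙 a) X,
    D.lift (𝟙 a) X = (D.inc a).map (eqToHom e) := by
  obtain ⟨e, he⟩ := lift_id X
  refine ⟨e.symm, ?_⟩
  rw [← Category.id_comp ((D.inc a).map _), ← he, Category.assoc,
    ← CategoryTheory.Functor.map_comp, eqToHom_trans, eqToHom_refl,
    CategoryTheory.Functor.map_id, Category.comp_id]

theorem lift_comp' {a b c : A} (f : a ⟶ b) (g : b ⟶ c) (X : D.cat a) :
    ∃ e : D.push g (D.push f X) = D.push (f ≫ g) X,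
      D.lift (f ≫ g) X = D.lift f X ≫ D.lift g (D.push f X) ≫ (D.inc c).map (eqToHom e) := by
  obtain ⟨e, he⟩ := lift_comp f g X
  refine ⟨e.symm, ?_⟩
  rw [← reassoc_of% he, ← CategoryTheory.Functor.map_comp, eqToHom_trans, eqToHom_refl,
    CategoryTheory.Functor.map_id, Category.comp_id]

theorem pushMap_id {a : A} {X Y : D.cat a} (α : X ⟶ Y) (e : D.push (𝟙 a) X = X)
    (e' : Y = D.push (𝟙 a) Y) : pushMap (𝟙 a) α = eqToHom e ≫ α ≫ eqToHom e' := by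
  obtain ⟨_, h⟩ := lift_id X
  obtain ⟨_, h'⟩ := lift_id' Y
  refine hom_ext ?_
  rw [lift_pushMap, h', CategoryTheory.Functor.map_comp, reassoc_of% h,
    CategoryTheory.Functor.map_comp]

theorem pushMap_comp {a b c : A} (f : a ⟶ b) (g : b ⟶ c) {X Y : D.cat a} (α : X ⟶ Y)
    (e : D.push (f ≫ g) X = D.push g (D.push f X)) (e' : D.push g (D.push f Y) = D.push (f ≫ g) Y) :
    pushMap (f ≫ g) α = eqToHom e ≫ pushMap g (pushMap f α) ≫ eqToHom e' := by
  obtain ⟨_, h⟩ := lift_comp f g X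
  obtain ⟨_, h'⟩ := lift_comp' f g Y
  refine hom_ext ?_
  rw [lift_pushMap, h', CategoryTheory.Functor.map_comp, reassoc_of% h,
    CategoryTheory.Functor.map_comp, lift_pushMap_assoc, lift_pushMap_assoc]

theorem pushFunctor_id (a : A) : (pushFunctor (𝟙 a) : D.cat a ⥤ D.cat a) = 𝟭 _ :=
  CategoryTheory.Functor.ext (fun X => (lift_id X).choose) fun _ _ α => pushMap_id α _ _

theorem pushFunctor_comp {a b c : A} (f : a ⟶ b) (g : b ⟶ c) :
    (pushFunctor (f ≫ g) : D.cat a ⥤ D.cat c) = pushFunctor f ⋙ pushFunctor g :=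
  CategoryTheory.Functor.ext (fun X => (lift_comp f g X).choose) fun _ _ α =>
    pushMap_comp f g α _ _

/-- Lift `δ` to a 2-cell with target the chosen lift of `g`. Its source lies over `f`, so it factors
through the chosen lift of `f`, and the vertical factor is the value of the 2-functor of fibres on
`δ`. -/
theorem exists_cell {a b : A} {f g : a ⟶ b} (δ : f ⟶ g) (X : D.cat a) :
    ∃ α : D.push f X ⟶ D.push g X,
      Cell P δ (D.lift f X ≫ (D.inc b).map α) (D.lift g X) := by
  obtain ⟨φ, κ, h⟩ := exists_lift₂ D.locallyDiscrete (D.lift_isHomLift g X) δ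
  obtain ⟨α, rfl⟩ := D.exists_factor f φ h.left
  exact ⟨α, κ, h⟩

/-- The component at `X` of the reindexing transformation along a 2-cell. -/
noncomputable def cell {a b : A} {f g : a ⟶ b} (δ : f ⟶ g) (X : D.cat a) :
    D.push f X ⟶ D.push g X :=
  (exists_cell δ X).choose

theorem cell_spec {a b : A} {f g : a ⟶ b} (δ : f ⟶ g) (X : D.cat a) :
    Cell P δ (D.lift f X ≫ (D.inc b).map (cell δ X)) (D.lift g X) :=
  (exists_cell δ X).choose_spec

theorem cell_comp_spec {a b : A} {f g : a ⟶ b} (δ : f ⟶ g) {X : D.cat a} {Z : D.cat b}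
    (β : D.push g X ⟶ Z) :
    Cell P δ (D.lift f X ≫ (D.inc b).map (cell δ X ≫ β)) (D.lift g X ≫ (D.inc b).map β) := by
  rw [CategoryTheory.Functor.map_comp, ← Category.assoc]
  exact (cell_spec δ X).whiskerRight_id (D.isHomLift β)

/-- Characterises `cell δ X ≫ β` by the existence of a 2-cell over `δ`: lifts with a common target
have a common source, and `hom_ext` cancels the chosen lift. The equations for `cell` reduce to
exhibiting such 2-cells by whiskering and composing. -/
theorem eq_cell_comp {a b : A} {f g : a ⟶ b} {δ : f ⟶ g} {X : D.cat a} {Z : D.cat b}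
    {α : D.push f X ⟶ Z} {β : D.push g X ⟶ Z}
    (h : Cell P δ (D.lift f X ≫ (D.inc b).map α) (D.lift g X ≫ (D.inc b).map β)) :
    α = cell δ X ≫ β :=
  hom_ext (h.unique D.locallyDiscrete (cell_comp_spec δ β))

theorem eq_cell {a b : A} {f g : a ⟶ b} {δ : f ⟶ g} {X : D.cat a} {α : D.push f X ⟶ D.push g X}
    (h : Cell P δ (D.lift f X ≫ (D.inc b).map α) (D.lift g X)) : α = cell δ X :=
  hom_ext (h.unique D.locallyDiscrete (cell_spec δ X))

theorem cell_naturality {a b : A} {f g : a ⟶ b} (δ : f ⟶ g) {X Y : D.cat a} (α : X ⟶ Y) :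
    pushMap f α ≫ cell δ Y = cell δ X ≫ pushMap g α := by
  refine eq_cell_comp ?_
  rw [lift_pushMap, CategoryTheory.Functor.map_comp, lift_pushMap_assoc]
  exact (cell_spec δ Y).id_whiskerLeft (D.isHomLift α)

theorem cell_id {a b : A} (f : a ⟶ b) (X : D.cat a) : cell (𝟙 f) X = 𝟙 (D.push f X) := by
  refine (eq_cell ?_).symm
  rw [CategoryTheory.Functor.map_id, Category.comp_id]
  exact ⟨_, Lift₂.id (D.lift_isHomLift f X)⟩

theorem cell_comp {a b : A} {f g h : a ⟶ b} (δ : f ⟶ g) (γ : g ⟶ h) (X : D.cat a) :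
    cell (δ ≫ γ) X = cell δ X ≫ cell γ X :=
  (eq_cell ((cell_comp_spec δ (cell γ X)).comp (cell_spec γ X))).symm

/-- The required 2-cell over `f ◁ δ` is the lift of `δ` whiskered by `D.lift f X`; the `eqToHom`s
come from splitting the chosen lifts of the two composites. -/
theorem cell_whiskerLeft {a b c : A} (f : a ⟶ b) {g h : b ⟶ c} (δ : g ⟶ h) (X : D.cat a)
    (e : D.push (f ≫ g) X = D.push g (D.push f X))
    (e' : D.push h (D.push f X) = D.push (f ≫ h) X) :
    cell (f ◁ δ) X = eqToHom e ≫ cell δ (D.push f X) ≫ eqToHom e' := by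
  obtain ⟨_, h₁⟩ := lift_comp f g X
  obtain ⟨_, h₂⟩ := lift_comp' f h X
  refine (eq_cell ?_).symm
  rw [h₂, CategoryTheory.Functor.map_comp, reassoc_of% h₁]
  exact (cell_comp_spec δ (eqToHom e')).whiskerLeft (D.lift_isHomLift f X)

theorem cell_whiskerRight {a b c : A} {f g : a ⟶ b} (δ : f ⟶ g) (h : b ⟶ c) (X : D.cat a)
    (e : D.push (f ≫ h) X = D.push h (D.push f X))
    (e' : D.push h (D.push g X) = D.push (g ≫ h) X) :
    cell (δ ▷ h) X = eqToHom e ≫ pushMap h (cell δ X) ≫ eqToHom e' := by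
  obtain ⟨_, h₁⟩ := lift_comp f h X
  obtain ⟨_, h₂⟩ := lift_comp' g h X
  refine (eq_cell ?_).symm
  rw [h₂, CategoryTheory.Functor.map_comp, reassoc_of% h₁, CategoryTheory.Functor.map_comp,
    lift_pushMap_assoc, ← Category.assoc]
  exact (cell_spec δ X).whiskerRight inferInstance

variable (D) in
/-- The strict 2-functor `A ⥤ Cat` of fibres of a split discrete 2-opfibration. -/
noncomputable def fibres : StrictPseudofunctor A Cat.{t, t} :=
  StrictPseudofunctor.mk'' {
    obj := D.cat
    map f := Cat.Hom.ofFunctor (pushFunctor f)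
    map₂ δ := Cat.Hom₂.ofNatTrans ⟨cell δ, fun _ _ α => cell_naturality δ α⟩
    map₂_id f := Cat.Hom₂.ext (NatTrans.ext (funext fun X => cell_id f X))
    map₂_comp δ γ := Cat.Hom₂.ext (NatTrans.ext (funext fun X => cell_comp δ γ X))
    map_id a := Cat.Hom.ext (pushFunctor_id a)
    map_comp f g := Cat.Hom.ext (pushFunctor_comp f g)
    map₂_whisker_left {a b c} f g h δ := Cat.Hom₂.ext (NatTrans.ext (funext fun X => by
      rw [Cat.Hom₂.comp_app, Cat.Hom₂.comp_app, Cat.eqToHom_app, Cat.eqToHom_app]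
      exact cell_whiskerLeft f δ X _ _))
    map₂_whisker_right δ h := Cat.Hom₂.ext (NatTrans.ext (funext fun X => by
      rw [Cat.Hom₂.comp_app, Cat.Hom₂.comp_app, Cat.eqToHom_app, Cat.eqToHom_app]
      exact cell_whiskerRight δ h X _ _)) }

end FibreModel

end

end TwoElements

namespace TwoElements

/-! ### The comparison isomorphism over `A` -/

namespace FibreModel

variable {A : Type u₁} [Bicategory.{w₁, v₁} A] [Strict A] {E : Type u₂} [Bicategory.{w₂, v₂} E]
  [Strict E] {P : StrictPseudofunctor E A} {S : Splitting P.toFunctor}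
  (D : FibreModel.{w₁, w₂, v₁, v₂, u₁, u₂, t} P S)

/-- The comparison `∫(fibres) ⥤ E` on 1-cells. -/
def total {B C : A} (f : B ⟶ C) {x : D.cat B} {y : D.cat C} (a : D.push f x ⟶ y) :
    (D.inc B).obj x ⟶ (D.inc C).obj y :=
  D.lift f x ≫ (D.inc C).map a

theorem isHomLift_total {B C : A} (f : B ⟶ C) {x : D.cat B} {y : D.cat C} (a : D.push f x ⟶ y) :
    P.toFunctor.IsHomLift f (D.total f a) :=
  IsHomLift.comp_lift_id_right P.toFunctor f _ _

variable {D}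

theorem total_id {B : A} (x : D.cat B) (e : D.push (𝟙 B) x = x) :
    D.total (𝟙 B) (eqToHom e) = 𝟙 _ := by
  obtain ⟨_, h⟩ := lift_id x
  exact h

theorem total_comp {B C K : A} (f : B ⟶ C) (g : C ⟶ K) {x : D.cat B} {y : D.cat C} {z : D.cat K}
    (a : D.push f x ⟶ y) (b : D.push g y ⟶ z) (e : D.push (f ≫ g) x = D.push g (D.push f x)) :
    D.total (f ≫ g) (eqToHom e ≫ pushMap g a ≫ b) = D.total f a ≫ D.total g b := by
  obtain ⟨_, h⟩ := lift_comp f g x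
  rw [total, total, total, CategoryTheory.Functor.map_comp, CategoryTheory.Functor.map_comp,
    reassoc_of% h, lift_pushMap_assoc, Category.assoc]

theorem exists_total_eq {B C : A} {x : D.cat B} {y : D.cat C}
    (φ : (D.inc B).obj x ⟶ (D.inc C).obj y) :
    ∃ (f : B ⟶ C) (a : D.push f x ⟶ y), D.total f a = φ := by
  have ex : ∀ {B C : A} {x y : E} (φ : x ⟶ y) (hx : P.obj x = B) (hy : P.obj y = C),
      ∃ f : B ⟶ C, P.toFunctor.IsHomLift f φ := by
    rintro _ _ x y φ rfl rfl
    exact ⟨P.map φ, IsHomLift.map (p := P.toFunctor) φ⟩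
  obtain ⟨f, hf⟩ := ex φ (obj_inc x) (obj_inc y)
  obtain ⟨a, ha⟩ := D.exists_factor f φ hf
  exact ⟨f, a, ha⟩

theorem total_chosen_iff {B C : A} (f : B ⟶ C) {x : D.cat B} {y : D.cat C}
    (a : D.push f x ⟶ y) : S.chosen (D.total f a) ↔ ∃ e, a = eqToHom e := by
  constructor
  · intro h
    obtain ⟨e, he⟩ := eq_lift (D.isHomLift_total f a) h
    exact ⟨e, (hom_ext he).symm⟩
  · rintro ⟨rfl, rfl⟩
    rw [total, eqToHom_refl, CategoryTheory.Functor.map_id, Category.comp_id]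
    exact D.lift_chosen f x

/-- The equation on the right is the one defining 2-cells in a 2-category of elements, so 2-cells
upstairs and in `∫` of the fibres are governed by the same condition. -/
theorem cell_total_iff {B C : A} {f g : B ⟶ C} (δ : f ⟶ g) {x : D.cat B} {y : D.cat C}
    (a : D.push f x ⟶ y) (b : D.push g x ⟶ y) :
    Cell P δ (D.total f a) (D.total g b) ↔ a = cell δ x ≫ b :=
  ⟨fun h => eq_cell_comp h, by
    rintro rfl
    exact cell_comp_spec δ b⟩

/-- `P` is faithful on 2-cells, so the 2-cell laws of the comparison only have to be checked in `A`.
-/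
theorem lift₂_unique' {a b : A} {f g : a ⟶ b} {x y : E} {φ ψ : x ⟶ y} {κ κ' : φ ⟶ ψ}
    {δ : f ⟶ g} (D : FibreModel.{w₁, w₂, v₁, v₂, u₁, u₂, t} P S) (h : Lift₂ P κ δ)
    (h' : Lift₂ P κ' δ) : κ = κ' :=
  eq_of_heq (lift₂_unique D.locallyDiscrete h h').2

variable (D)

/-- The comparison 2-functor on 1-cells. -/
def comparisonMap {X Y : Elements D.fibres} (f : X ⟶ Y) :
    (D.inc X.base).obj X.fiber ⟶ (D.inc Y.base).obj Y.fiber :=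
  D.total f.base f.fiber

theorem isHomLift_comparisonMap {X Y : Elements D.fibres} (f : X ⟶ Y) :
    P.toFunctor.IsHomLift f.base (D.comparisonMap f) :=
  D.isHomLift_total (B := X.base) (C := Y.base) f.base f.fiber

theorem exists_comparisonMap₂ {X Y : Elements D.fibres} {f g : X ⟶ Y} (δ : f ⟶ g) :
    Cell P δ.base (D.comparisonMap f) (D.comparisonMap g) :=
  (cell_total_iff δ.base _ _).2 δ.comm

/-- The comparison 2-functor on 2-cells. -/
noncomputable def comparisonMap₂ {X Y : Elements D.fibres} {f g : X ⟶ Y} (δ : f ⟶ g) :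
    D.comparisonMap f ⟶ D.comparisonMap g :=
  (D.exists_comparisonMap₂ δ).choose

theorem lift₂_comparisonMap₂ {X Y : Elements D.fibres} {f g : X ⟶ Y} (δ : f ⟶ g) :
    Lift₂ P (D.comparisonMap₂ δ) δ.base :=
  (D.exists_comparisonMap₂ δ).choose_spec

theorem comparisonMap_id (X : Elements D.fibres) : D.comparisonMap (𝟙 X) = 𝟙 _ := by
  rw [comparisonMap, Elements.id_fiber, Elements.mapId_app]
  exact total_id _ _

theorem comparisonMap_comp {X Y Z : Elements D.fibres} (f : X ⟶ Y) (g : Y ⟶ Z) :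
    D.comparisonMap (f ≫ g) = D.comparisonMap f ≫ D.comparisonMap g := by
  rw [comparisonMap, Elements.comp_fiber, Elements.mapComp_app]
  exact total_comp f.base g.base f.fiber g.fiber _

/-- The comparison 2-functor from the 2-category of elements of the fibres. -/
noncomputable def comparison : StrictPseudofunctor (Elements D.fibres) E :=
  StrictPseudofunctor.mk'' {
    obj X := (D.inc X.base).obj X.fiber
    map := D.comparisonMap
    map₂ := D.comparisonMap₂
    map₂_id f := lift₂_unique' D (D.lift₂_comparisonMap₂ _) (Lift₂.id (D.isHomLift_comparisonMap f))
    map₂_comp δ γ := lift₂_unique' D (D.lift₂_comparisonMap₂ _)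
      ((D.lift₂_comparisonMap₂ δ).comp (D.lift₂_comparisonMap₂ γ))
    map_id := D.comparisonMap_id
    map_comp := D.comparisonMap_comp
    map₂_whisker_left f _ _ δ := lift₂_unique' D (D.lift₂_comparisonMap₂ _)
      (((D.lift₂_comparisonMap₂ δ).whiskerLeft (D.isHomLift_comparisonMap f)).conj _ _)
    map₂_whisker_right δ f := lift₂_unique' D (D.lift₂_comparisonMap₂ _)
      (((D.lift₂_comparisonMap₂ δ).whiskerRight (D.isHomLift_comparisonMap f)).conj _ _) }

theorem comparison_comp_proj : D.comparison.comp P = Elements.proj D.fibres :=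
  Elements.twoFunctor_ext_heq (fun X => obj_inc X.fiber)
    (fun f => isHomLift_heq P (D.isHomLift_comparisonMap f))
    (fun δ => (D.lift₂_comparisonMap₂ δ).heq)

theorem comparison_obj_bijective : Function.Bijective D.comparison.obj := by
  constructor
  · rintro ⟨B, x⟩ ⟨C, y⟩ h
    change (D.inc B).obj x = (D.inc C).obj y at h
    obtain rfl : B = C := (obj_inc (D := D) (a := B) x).symm.trans
      ((congrArg P.obj h).trans (obj_inc (D := D) (a := C) y))
    rw [D.obj_injective B h]
  · intro y
    obtain ⟨Y, hY⟩ := D.exists_obj (x := y) rfl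
    exact ⟨⟨P.obj y, Y⟩, hY⟩

theorem comparison_map_bijective (X Y : Elements D.fibres) :
    Function.Bijective fun f : X ⟶ Y => D.comparison.map f := by
  constructor
  · rintro ⟨f, a⟩ ⟨g, b⟩ h
    change D.total f a = D.total g b at h
    have hf : P.toFunctor.IsHomLift f (D.total f a) :=
      D.isHomLift_total (B := X.base) (C := Y.base) f a
    have hg : P.toFunctor.IsHomLift g (D.total g b) :=
      D.isHomLift_total (B := X.base) (C := Y.base) g b
    rw [h] at hf
    -- The base is recovered by applying `P`; the fibre part is then recovered because the chosen
    -- lift is opcartesian.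
    obtain rfl := isHomLift_unique P hf hg
    obtain rfl : a = b := hom_ext h
    rfl
  · intro φ
    obtain ⟨f, a, h⟩ := exists_total_eq (D := D) φ
    exact ⟨⟨f, a⟩, h⟩

theorem comparison_map₂_bijective {X Y : Elements D.fibres} (f g : X ⟶ Y) :
    Function.Bijective fun δ : f ⟶ g => D.comparison.map₂ δ := by
  constructor
  · intro δ γ h
    have hδ : Lift₂ P (D.comparisonMap₂ δ) δ.base := D.lift₂_comparisonMap₂ δ
    have hγ : Lift₂ P (D.comparisonMap₂ γ) γ.base := D.lift₂_comparisonMap₂ γ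
    change D.comparisonMap₂ δ = D.comparisonMap₂ γ at h
    rw [h] at hδ
    exact Elements.hom₂_ext (hδ.base_unique hγ)
  · intro κ
    obtain ⟨δ, hδ⟩ := Lift₂.exists_base (D.isHomLift_comparisonMap f)
      (D.isHomLift_comparisonMap g) κ
    exact ⟨⟨δ, (cell_total_iff δ _ _).1 ⟨κ, hδ⟩⟩,
      lift₂_unique' D (D.lift₂_comparisonMap₂ _) hδ⟩

theorem chosen_comparison_iff {X Y : Elements D.fibres} (f : X ⟶ Y) :
    S.chosen (D.comparison.map f) ↔ Elements.chosen D.fibres f :=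
  total_chosen_iff f.base f.fiber

end FibreModel

section

variable {A : Type u} [Bicategory.{w, v} A] [Strict A]

/-- Every split discrete 2-opfibration with small fibres is isomorphic over `A` to a 2-category of
elements, by an isomorphism that preserves and reflects the chosen lifts. -/
theorem exists_iso_elements (Q : SplitDiscreteTwoOpfibration.{w, v, u, t} A) :
    ∃ (F : StrictPseudofunctor A Cat.{t, t}) (H : (elementsObj F).toOver ⟶ Q.toOver)
      (K : Q.toOver ⟶ (elementsObj F).toOver),
      H ≫ K = 𝟙 (elementsObj F).toOver ∧ K ≫ H = 𝟙 Q.toOver ∧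
      ∀ ⦃X Y : Elements F⦄ (f : X ⟶ Y),
        Q.splitting.chosen (H.functor.map f) ↔ Elements.chosen F f := by
  obtain ⟨D⟩ := nonempty_fibreModel.{w, w, v, max v t, u, max u t, t} Q.splitting Q.locallyDiscrete
    Q.small_fiber Q.locallySmall_fiber
  obtain ⟨Ψ, h₁, h₂⟩ := exists_inverse D.comparison_obj_bijective D.comparison_map_bijective
    D.comparison_map₂_bijective
  refine ⟨D.fibres, ⟨D.comparison, D.comparison_comp_proj⟩, ⟨Ψ, ?_⟩, TwoCatOver.hom_ext h₁,
    TwoCatOver.hom_ext h₂, fun _ _ f => D.chosen_comparison_iff f⟩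
  change Ψ.comp (Elements.proj D.fibres) = Q.toOver.proj
  rw [← D.comparison_comp_proj, ← comp_assoc', h₂, id_comp']

end

end TwoElements

namespace TwoElements

/-! ### Restriction to the sub-2-categories and the main theorem -/

section

variable {B : Type u₁} [Bicategory.{w₁, v₁} B] [Strict B] {C : Type u₂} [Bicategory.{w₂, v₂} C]
  [Strict C]

/-- A 2-equivalence restricts to a 2-equivalence between the wide sub-2-categories given by two
classes of 1-cells, if it preserves and reflects these classes, and if every object of the target
is isomorphic to an object of the image by an isomorphism in the given class. -/
theorem IsTwoEquivalence.restrict {W : OneCellProperty B} {V : OneCellProperty C}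
    {Φ : StrictPseudofunctor B C} (hΦ : IsTwoEquivalence Φ)
    (h : ∀ {x y : B} (f : x ⟶ y), W.holds f ↔ V.holds (Φ.map f))
    (h' : ∀ c : C, ∃ (b : B) (f : Φ.obj b ⟶ c) (g : c ⟶ Φ.obj b),
      V.holds f ∧ V.holds g ∧ f ≫ g = 𝟙 (Φ.obj b) ∧ g ≫ f = 𝟙 c) :
    IsTwoEquivalence (WideSub.restrict (W := W) (V := V) Φ fun f => (h f).1) where
  bijective_map x y := by
    constructor
    · intro f g hfg
      exact WideSub.hom_ext ((hΦ.bijective_map _ _).1 (congrArg WideSub.Hom.hom hfg))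
    · intro g
      obtain ⟨f, hf⟩ := (hΦ.bijective_map _ _).2 g.hom
      -- Reflection of the class is what puts the preimage into the sub-2-category.
      refine ⟨⟨f, (h f).2 ?_⟩, WideSub.hom_ext hf⟩
      change Φ.map f = g.hom at hf
      rw [hf]
      exact g.property
  bijective_map₂ f g := by
    constructor
    · intro η θ hηθ
      exact WideSub.hom₂_ext ((hΦ.bijective_map₂ _ _).1 (congrArg WideSub.Hom₂.hom hηθ))
    · intro θ
      obtain ⟨η, hη⟩ := (hΦ.bijective_map₂ _ _).2 θ.hom
      exact ⟨⟨η⟩, WideSub.hom₂_ext hη⟩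
  essSurj c := by
    obtain ⟨b, f, g, hf, hg, hfg, hgf⟩ := h' c.obj
    exact ⟨⟨b⟩, ⟨f, hf⟩, ⟨g, hg⟩, WideSub.hom_ext hfg, WideSub.hom_ext hgf⟩

end

variable {A : Type u} [Bicategory.{w, v} A] [Strict A]

/-- An opcartesian 1-cell is a chosen lift followed by an isomorphism. The first goes to a chosen,
hence opcartesian, 1-cell and the second to an isomorphism. -/
theorem cartesian_of_cleavagePreserving {P Q : Fib.{w, v, u, t} A} (H : P ⟶ Q)
    (h : (cleavagePreserving A).holds H) : (cartesian A).holds H := by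
  intro x y φ hφ
  obtain ⟨⟨z, c⟩, ⟨hc, hc'⟩, -⟩ := P.splitting.existsUnique_lift x (P.toOver.proj.map φ)
  have hc'' : P.toOver.proj.toFunctor.IsStronglyCocartesian (P.toOver.proj.map φ) c :=
    isStronglyCocartesian_of_isHomLift hc (P.splitting.cocartesian c hc')
  -- Two opcartesian lifts of the same 1-cell differ by a unique isomorphism of their codomains.
  obtain ⟨χ, hχ, rfl⟩ : ∃ χ : z ⟶ y, IsIso χ ∧ c ≫ χ = φ := by
    let i := Functor.IsStronglyCocartesian.codomainIsoOfBaseIso P.toOver.proj.toFunctor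
      (g := Iso.refl (P.toOver.proj.obj y)) (Category.comp_id (P.toOver.proj.map φ)).symm c φ
    exact ⟨i.hom, inferInstance, Functor.IsStronglyCocartesian.fac P.toOver.proj.toFunctor
      (P.toOver.proj.map φ) c (Category.comp_id _).symm φ⟩
  have h₁ : Q.toOver.proj.toFunctor.IsStronglyCocartesian
      (Q.toOver.proj.map (H.hom.functor.map c)) (H.hom.functor.map c) :=
    Q.splitting.cocartesian _ (h c hc')
  have h₂ : IsIso (H.hom.functor.map χ) :=
    inferInstanceAs (IsIso (H.hom.functor.toFunctor.map χ))
  have h₃ : Q.toOver.proj.toFunctor.IsHomLift (Q.toOver.proj.map (H.hom.functor.map χ))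
      (H.hom.functor.map χ) := IsHomLift.map (p := Q.toOver.proj.toFunctor) _
  have h₄ := Functor.IsStronglyCocartesian.of_isIso Q.toOver.proj.toFunctor
      (Q.toOver.proj.map (H.hom.functor.map χ)) (H.hom.functor.map χ)
  rw [H.hom.functor.map_comp, Q.toOver.proj.map_comp]
  exact Functor.IsStronglyCocartesian.comp _

theorem exists_iso_cleavagePreserving (Q : Fib.{w, v, u, t} A) :
    ∃ (F : LaxCopresheaf.{w, v, u, t} A) (H : (elements A).obj F ⟶ Q)
      (K : Q ⟶ (elements A).obj F), (cleavagePreserving A).holds H ∧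
      (cleavagePreserving A).holds K ∧ H ≫ K = 𝟙 ((elements A).obj F) ∧ K ≫ H = 𝟙 Q := by
  obtain ⟨F, H, K, hHK, hKH, h⟩ := exists_iso_elements Q
  refine ⟨F, InducedBicategory.mkHom H, InducedBicategory.mkHom K, fun X Y f hf => (h f).2 hf,
    fun x y φ hφ => (h (K.functor.map φ)).1 ?_, InducedBicategory.hom_ext hHK,
    InducedBicategory.hom_ext hKH⟩
  -- Because `H` reflects chosen lifts, `K` preserves them once `H (K φ)` is chosen. Generalising
  -- the composite to `G` avoids transporting `φ` along `K ≫ H = 𝟙`.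
  have key : ∀ G : Q.toOver ⟶ Q.toOver, G = 𝟙 Q.toOver → Q.splitting.chosen (G.functor.map φ) := by
    rintro _ rfl
    exact hφ
  exact key _ hKH

theorem elements_isTwoEquivalence : IsTwoEquivalence (elements.{w, v, u, t} A) where
  bijective_map := elements_bijective_map A
  bijective_map₂ := elements_bijective_map₂ A
  essSurj Q := by
    obtain ⟨F, H, K, -, -, h⟩ := exists_iso_cleavagePreserving Q
    exact ⟨F, H, K, h⟩

end TwoElements

theorem mainTheorem6 (A : Type u) [Bicategory.{w, v} A] [Strict A] :
    TwoElements.IsTwoEquivalence (TwoElements.elements.{w, v, u, t} A) ∧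
    (∃ h : ∀ {F G : TwoElements.LaxCopresheaf.{w, v, u, t} A} (φ : F ⟶ G),
        (TwoElements.pseudonatural A).holds φ →
          (TwoElements.cartesian A).holds ((TwoElements.elements A).map φ),
      TwoElements.IsTwoEquivalence
        (TwoElements.WideSub.restrict (W := TwoElements.pseudonatural A)
          (V := TwoElements.cartesian A) (TwoElements.elements.{w, v, u, t} A) h)) ∧
    (∃ h : ∀ {F G : TwoElements.LaxCopresheaf.{w, v, u, t} A} (φ : F ⟶ G),
        (TwoElements.twoNatural A).holds φ →
          (TwoElements.cleavagePreserving A).holds ((TwoElements.elements A).map φ),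
      TwoElements.IsTwoEquivalence
        (TwoElements.WideSub.restrict (W := TwoElements.twoNatural A)
          (V := TwoElements.cleavagePreserving A) (TwoElements.elements.{w, v, u, t} A) h)) := by
  refine ⟨TwoElements.elements_isTwoEquivalence,
    ⟨fun φ => (TwoElements.pseudonatural_iff_cartesian A φ).1,
      TwoElements.elements_isTwoEquivalence.restrict
        (fun φ => TwoElements.pseudonatural_iff_cartesian A φ) fun Q => ?_⟩,
    ⟨fun φ => (TwoElements.twoNatural_iff_cleavagePreserving A φ).1,
      TwoElements.elements_isTwoEquivalence.restrict
        (fun φ => TwoElements.twoNatural_iff_cleavagePreserving A φ)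
        TwoElements.exists_iso_cleavagePreserving⟩⟩
  -- Only the pseudonatural case remains: the cleavage preserving isomorphism and its inverse are
  -- both cartesian.
  obtain ⟨F, H, K, hH, hK, h⟩ := TwoElements.exists_iso_cleavagePreserving Q
  exact ⟨F, H, K, TwoElements.cartesian_of_cleavagePreserving H hH,
    TwoElements.cartesian_of_cleavagePreserving K hK, h⟩
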